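/- Let $X$ be a (nonzero) real Banach space with dual $X^*$. For a multivalued operator $T:X\rightrightarrows X^*$ write $D_T=\{x\in X: T(x)\neq\emptyset\}$ and $G(T)=\{(x,x^*): x^*\in T(x)\}$; $T$ is monotone if $\langle x^*-y^*,x-y\rangle\ge 0$ for all $(x,x^*),(y,y^*)\in G(T)$, and maximal monotone if moreover no monotone operator has a graph strictly containing $G(T)$. Sums of operators are pointwise, $(T+S)(x)=T(x)+S(x)$. For $C\subset X$, $I_C$ is the function equal to $0$ on $C$ and $+\infty$ on $X\setminus C$, and $\partial I_C$ is its subdifferential. For a monotone operator $T$ let $$\mathcal C_0(T)=\{C\subset X: C\text{ closed, convex, } D_T\cap\operatorname{int}C\ne\emptyset\},$$ $$\mathcal C_1(T)=\Bigl\{C\subset X: C\text{ closed, convex, }\bigcup_{\lambda>0}\lambda(\operatorname{co}D_T-C)\text{ is a closed linear subspace of }X\Bigr\},$$ and call $T$ $\mathcal C_i$-maximal ($i\in\{0,1\}$) if $T+\partial I_C$ is maximal monotone for every $C\in\mathcal C_i(T)$. For $y\in X$ and $A\subset X$ put $K_{y,A}=\{(1-t)y+ta: 0\le t\le1,\ a\in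 A\}$. A monotone operator $S$ is directionally inf bounded at $x\in D_S$ if for every $y\in X$ there exist $\varepsilon,M>0$ such that for every $z\in K_{y,B(x,\varepsilon)}\cap D_S$ there is $z^*\in S(z)$ with $\langle z^*,z-y\rangle\le M\|z-y\|$, where $B(x,\varepsilon)$ is the ball of centre $x$ and radius $\varepsilon$. **Theorem.** Let $T,S:X\rightrightarrows X^*$ be maximal monotone operators with $D_T\cap\overline{D_S}\subset D_S$. 1. If $T$ is $\mathcal C_1$-maximal, $\overline{D_S}\in\mathcal C_1(T)$, and there exists $x_0\in D_T\cap D_S$ such that $S$ is directionally inf bounded at $x_0$, then $T+S$ is maximal monotone. 2. If $T$ is $\mathcal C_0$-maximal and $D_T\cap\operatorname{int}D_S\neq\emptyset$, then $T+S$ is maximal monotone. -/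

import Mathlib

open Set Metric
open scoped Pointwise

namespace MonotoneOperator

variable {X : Type*} [NormedAddCommGroup X] [NormedSpace ℝ X]

/-- The graph `G(T)` of a multivalued operator `T : X ⇉ X*`. -/
def graph (T : X → Set (StrongDual ℝ X)) : Set (X × StrongDual ℝ X) :=
  {p | p.2 ∈ T p.1}

/-- The domain `D_T = {x | T x ≠ ∅}`. -/
def dom (T : X → Set (StrongDual ℝ X)) : Set X :=
  {x | (T x).Nonempty}

/-- Monotonicity: `⟨x* - y*, x - y⟩ ≥ 0` for all `(x, x*), (y, y*) ∈ G(T)`. -/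
def IsMonotone (T : X → Set (StrongDual ℝ X)) : Prop :=
  ∀ p ∈ graph T, ∀ q ∈ graph T, 0 ≤ (p.2 - q.2) (p.1 - q.1)

/-- Maximal monotonicity: `T` is monotone and no monotone operator has a strictly larger graph. -/
def IsMaximalMonotone (T : X → Set (StrongDual ℝ X)) : Prop :=
  IsMonotone T ∧ ¬ ∃ S : X → Set (StrongDual ℝ X), IsMonotone S ∧ graph T ⊂ graph S

open Classical in
/-- The indicator function `I_C` of convex analysis: `0` on `C` and `+∞` off `C`. -/
noncomputable def indicatorFun (C : Set X) : X → EReal :=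
  fun x => if x ∈ C then 0 else ⊤

/-- The subdifferential `∂f` of an extended-real-valued function: `x* ∈ ∂f(x)` iff `f x` is finite
and `f x + ⟨x*, y - x⟩ ≤ f y` for all `y`. -/
def subdifferential (f : X → EReal) : X → Set (StrongDual ℝ X) :=
  fun x => {xs | f x ≠ ⊤ ∧ f x ≠ ⊥ ∧ ∀ y, f x + ((xs (y - x) : ℝ) : EReal) ≤ f y}

/-- `∂I_C` is the normal cone operator of `C`. -/
theorem mem_subdifferential_indicatorFun {C : Set X} {x : X} {xs : StrongDual ℝ X} :
    xs ∈ subdifferential (indicatorFun C) x ↔ x ∈ C ∧ ∀ y ∈ C, xs (y - x) ≤ 0 := by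
  classical
  constructor
  · rintro ⟨h1, -, h3⟩
    have hx : x ∈ C := by
      by_contra hx
      exact h1 (by simp [indicatorFun, hx])
    refine ⟨hx, fun y hy => ?_⟩
    have h := h3 y
    simp only [indicatorFun, hx, hy, if_true, zero_add] at h
    exact_mod_cast h
  · rintro ⟨hx, h⟩
    refine ⟨by simp [indicatorFun, hx], by simp [indicatorFun, hx], fun y => ?_⟩
    by_cases hy : y ∈ C
    · simp only [indicatorFun, hx, hy, if_true, zero_add]
      exact_mod_cast h y hy
    · simp [indicatorFun, hy]

/-- `𝒞₀(T)`: the closed convex sets `C` with `D_T ∩ int C ≠ ∅`. -/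
def C0 (T : X → Set (StrongDual ℝ X)) : Set (Set X) :=
  {C | IsClosed C ∧ Convex ℝ C ∧ (dom T ∩ interior C).Nonempty}

/-- `𝒞₁(T)`: the closed convex sets `C` such that `⋃_{r > 0} r (co D_T - C)` is a closed
linear subspace of `X`. -/
def C1 (T : X → Set (StrongDual ℝ X)) : Set (Set X) :=
  {C | IsClosed C ∧ Convex ℝ C ∧
    ∃ Y : Submodule ℝ X, IsClosed (Y : Set X) ∧
      (Y : Set X) = ⋃ (r : ℝ) (_ : 0 < r), r • (convexHull ℝ (dom T) - C)}

/-- `T` is `𝒞₀`-maximal. Operators are added pointwise: `(T + S) x = T x + S x` is the Minkowski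
sum of two sets, which is empty when one of them is. -/
def IsC0Maximal (T : X → Set (StrongDual ℝ X)) : Prop :=
  ∀ C ∈ C0 T, IsMaximalMonotone (T + subdifferential (indicatorFun C))

/-- `T` is `𝒞₁`-maximal. -/
def IsC1Maximal (T : X → Set (StrongDual ℝ X)) : Prop :=
  ∀ C ∈ C1 T, IsMaximalMonotone (T + subdifferential (indicatorFun C))

/-- `K_{x,A} = {(1 - t) x + t a | 0 ≤ t ≤ 1, a ∈ A}`. -/
def coneHull (x : X) (A : Set X) : Set X :=
  {z | ∃ t : ℝ, 0 ≤ t ∧ t ≤ 1 ∧ ∃ a ∈ A, z = (1 - t) • x + t • a}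

/-- `T` is directionally inf bounded at `x ∈ D_T`. -/
def DirInfBoundedAt (T : X → Set (StrongDual ℝ X)) (x : X) : Prop :=
  x ∈ dom T ∧ ∀ y : X, ∃ ε : ℝ, 0 < ε ∧ ∃ M : ℝ, 0 < M ∧
    ∀ z ∈ coneHull y (closedBall x ε) ∩ dom T, ∃ zs ∈ T z, zs (z - y) ≤ M * ‖z - y‖

end MonotoneOperator

/-!
The sum `T + S` is shown to be maximal by taking a pair `(z, z*)` that is monotonically related to
it and splitting `z*` into a value of `T` and a value of `S` at `z`.

Write `C` for the closure of the domain of `S`, and let `x₀` be the point of directional inf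
boundedness. Maximality of the operators `T + ∂I_{C ∩ K}`, with `K` a thin cone whose apex is an
arbitrary point `ξ` and whose base surrounds `x₀`, yields a range condition
(`exists_apply_sub_le`): at some `a` the sum `T + S` has a value that decreases along `a - ξ` as
fast as desired. Directional inf boundedness with apex `ξ` supplies the value of `S`, and the part
of the normal vector that belongs to `C` is absorbed by `S`. With `ξ = z` this places `z` in both
domains. With `ξ` near `z` it shows that `z*` is dominated in each direction `v` by the sum of an
upper bound for `T` and an upper bound for `S` (`apply_le_of_mem_upperCone`), where `upperCone`
records bounds that may involve a multiple of `t (a - z)`.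

The splitting is then a Hahn–Banach problem in the space `Y` generated by `co D_T - C`: the two
families of bounds have to be decoupled, at the price of a Lipschitz estimate in the difference of
the directions. The estimate comes from two facts. The values of `S` are bounded above on `C` near
`x₀`, with linear growth (`DirInfBoundedAt.exists_forall_apply_sub_le`, a gliding hump argument);
and small vectors of `Y` are differences `e - c` with `T` bounded above at `e` and `c ∈ C` close to
`x₀` (`IsMonotone.exists_forall_eq_sub`, an open mapping theorem). This is `isMaximalMonotone_add`.

In the first part, intersecting `C` with `K` does not leave `𝒞₁(T)`. In the second part, local
boundedness of `S` at interior points of its domain gives directional inf boundedness, and `C` is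
convex by Rockafellar's theorem (`IsMaximalMonotone.convex_closure_dom`).
-/

open Set Metric
open scoped Pointwise

namespace MonotoneOperator

variable {X : Type*} [NormedAddCommGroup X] [NormedSpace ℝ X]
  {T S : X → Set (StrongDual ℝ X)}

/-! ### Monotonically related pairs -/

theorem IsMonotone.apply_le (hT : IsMonotone T) {a b : X} {as bs : StrongDual ℝ X}
    (ha : as ∈ T a) (hb : bs ∈ T b) : as (b - a) ≤ bs (b - a) := by
  have h := hT (b, bs) hb (a, as) ha
  simp only [sub_apply] at h
  linarith

theorem IsMonotone.add (hT : IsMonotone T) (hS : IsMonotone S) : IsMonotone (T + S) := by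
  rintro ⟨a, as⟩ ⟨t, ht, s, hs, rfl⟩ ⟨b, bs⟩ ⟨t', ht', s', hs', rfl⟩
  have h1 := hT.apply_le ht' ht
  have h2 := hS.apply_le hs' hs
  simp only [sub_apply, add_apply]
  linarith

/-- A pair monotonically related to the graph of a maximal monotone operator belongs to it. -/
theorem IsMaximalMonotone.mem_of_forall (hT : IsMaximalMonotone T) {x : X} {xs : StrongDual ℝ X}
    (h : ∀ a, ∀ as ∈ T a, xs (a - x) ≤ as (a - x)) : xs ∈ T x := by
  by_contra hx
  refine hT.2 ⟨fun a => {as | as ∈ T a ∨ (a = x ∧ as = xs)}, ?_, ?_⟩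
  · rintro ⟨a, as⟩ ha ⟨b, bs⟩ hb
    rcases ha with ha | ⟨ha, ha'⟩ <;> rcases hb with hb | ⟨hb, hb'⟩
    · exact hT.1 (a, as) ha (b, bs) hb
    · simp only at hb hb' ⊢
      subst hb hb'
      simpa using h a as ha
    · simp only at ha ha' ⊢
      subst ha ha'
      have := h b bs hb
      rw [← neg_sub b a, map_neg]
      simp only [sub_apply]
      linarith
    · simp only at ha ha' hb hb' ⊢
      subst ha ha' hb hb'
      simp
  · refine ⟨fun p hp => Or.inl hp, fun hsub => hx ?_⟩
    exact hsub (show (x, xs) ∈ graph _ from Or.inr ⟨rfl, rfl⟩)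

theorem isMaximalMonotone_of_forall (hT : IsMonotone T)
    (h : ∀ x : X, ∀ xs : StrongDual ℝ X, (∀ a, ∀ as ∈ T a, xs (a - x) ≤ as (a - x)) → xs ∈ T x) :
    IsMaximalMonotone T := by
  refine ⟨hT, ?_⟩
  rintro ⟨R, hR, hsub, hne⟩
  refine hne ?_
  rintro ⟨x, xs⟩ hx
  exact h x xs fun a as ha => hR.apply_le hx (hsub (show (a, as) ∈ graph T from ha))

/-- A maximal monotone operator absorbs the normal cones of the closure of its domain. -/
theorem IsMaximalMonotone.add_normal_mem (hS : IsMaximalMonotone S) {a : X}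
    {s n : StrongDual ℝ X} (hs : s ∈ S a) (hn : ∀ y ∈ closure (dom S), n (y - a) ≤ 0) :
    s + n ∈ S a := by
  refine hS.mem_of_forall fun b bs hb => ?_
  have h1 := hS.1.apply_le hs hb
  have h2 := hn b (subset_closure ⟨bs, hb⟩)
  rw [add_apply]
  linarith

/-! ### Two applications of the Hahn–Banach theorem -/

theorem exists_dual_prod_eq (f : StrongDual ℝ (X × ℝ)) :
    ∃ (g : StrongDual ℝ X) (α : ℝ), ∀ v r, f (v, r) = g v + r * α := by
  refine ⟨f.comp (ContinuousLinearMap.inl ℝ X ℝ), f (0, 1), fun v r => ?_⟩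
  rw [← smul_eq_mul, ← map_smul, ContinuousLinearMap.comp_apply, ContinuousLinearMap.inl_apply,
    ← map_add]
  simp

/-- A Hahn–Banach theorem of Mazur–Orlicz type: a convex family of affine constraints
`t v ≤ β` that satisfies `-M ‖v‖ ≤ β` is solvable by a continuous functional `t`. -/
theorem exists_dual_apply_le {K : Set (X × ℝ)} (hK : Convex ℝ K) (hne : K.Nonempty) {M : ℝ}
    (hM : 0 ≤ M) (h : ∀ p ∈ K, -(M * ‖p.1‖) ≤ p.2) :
    ∃ t : StrongDual ℝ X, ∀ p ∈ K, t p.1 ≤ p.2 := by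
  have hUo : IsOpen {p : X × ℝ | p.2 < -(M * ‖p.1‖)} := isOpen_lt (by fun_prop) (by fun_prop)
  have hUc : Convex ℝ {p : X × ℝ | p.2 < -(M * ‖p.1‖)} := by
    rintro ⟨x, r⟩ hx ⟨y, s⟩ hy a b ha hb hab
    simp only [mem_ofPred_eq, Prod.smul_mk, Prod.mk_add_mk, smul_eq_mul] at hx hy ⊢
    have h1 : ‖a • x + b • y‖ ≤ a * ‖x‖ + b * ‖y‖ := by
      refine (norm_add_le _ _).trans (le_of_eq ?_)
      rw [norm_smul, norm_smul, Real.norm_of_nonneg ha, Real.norm_of_nonneg hb]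
    have h2 := mul_le_mul_of_nonneg_left h1 hM
    rcases ha.eq_or_lt with rfl | ha'
    · have : b = 1 := by linarith
      subst this
      simpa using hy
    · nlinarith [mul_lt_mul_of_pos_left hx ha', mul_le_mul_of_nonneg_left hy.le hb]
  have hdisj : Disjoint {p : X × ℝ | p.2 < -(M * ‖p.1‖)} K := by
    rw [Set.disjoint_left]
    intro p hp hpK
    exact absurd (h p hpK) (not_le.2 hp)
  obtain ⟨f, u, hfU, hfK⟩ := geometric_hahn_banach_open hUc hUo hK hdisj
  obtain ⟨g, α, hf⟩ := exists_dual_prod_eq f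
  have hU : ∀ v r, r < -(M * ‖v‖) → g v + r * α < u := fun v r hr => by
    rw [← hf]
    exact hfU (v, r) hr
  have hV : ∀ v r, (v, r) ∈ K → u ≤ g v + r * α := fun v r hr => by
    rw [← hf]
    exact hfK (v, r) hr
  obtain ⟨⟨v₀, r₀⟩, hq⟩ := hne
  -- points just below the apex of the cone `r < -(M ‖v‖)` give `0 ≤ u` in the limit
  have hline : ∀ ε : ℝ, 0 < ε → -ε * α < u := fun ε hε => by
    simpa using hU 0 (-ε) (by simpa using hε)
  have hu : 0 ≤ u := by
    have h2 : Filter.Tendsto (fun ε : ℝ => -ε * α) (nhdsWithin 0 (Ioi 0)) (nhds (-0 * α)) :=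
      Filter.Tendsto.mono_left (Continuous.tendsto (by fun_prop) 0) nhdsWithin_le_nhds
    rw [neg_zero, zero_mul] at h2
    exact le_of_tendsto h2 (eventually_nhdsWithin_of_forall fun ε hε => (hline ε hε).le)
  have hα0 : 0 < α := by
    by_contra! hα1
    rcases hα1.lt_or_eq with hlt | heq
    · have h3 := hline (u / (-α) + 1) (by
        have : 0 ≤ u / (-α) := div_nonneg hu (by linarith)
        linarith)
      have h5 : u / (-α) * (-α) = u := div_mul_cancel₀ _ (by linarith)
      nlinarith
    · -- a vertical separating hyperplane would bound `g` above, forcing `g = 0`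
      have h6 : ∀ v : X, g v < u := fun v => by
        simpa [heq] using hU v (-(M * ‖v‖) - 1) (by simp)
      have h7 : g v₀ ≤ 0 := by
        by_contra! hv
        have := h6 ((u / g v₀) • v₀)
        rw [map_smul, smul_eq_mul, div_mul_cancel₀ _ hv.ne'] at this
        exact lt_irrefl _ this
      have h8 := hV v₀ r₀ hq
      have h9 := h6 0
      rw [map_zero] at h9
      rw [heq, mul_zero, add_zero] at h8
      linarith
  refine ⟨-(α⁻¹ • g), fun p hp => ?_⟩
  have h1 := hV p.1 p.2 hp
  rw [neg_apply, smul_apply, smul_eq_mul]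
  have h2 : 0 ≤ α⁻¹ * (g p.1 + p.2 * α) := mul_nonneg (inv_nonneg.2 hα0.le) (by linarith)
  have h3 : α⁻¹ * (p.2 * α) = p.2 := by field_simp
  rw [mul_add, h3] at h2
  linarith

/-- The normal cone of `C ∩ K` splits when `C` meets the interior of `K`. -/
theorem exists_normal_add_normal {C K : Set X} (hC : Convex ℝ C) (hK : Convex ℝ K)
    {x₀ a : X} (hxC : x₀ ∈ C) (hxK : x₀ ∈ interior K) (haC : a ∈ C) (haK : a ∈ K)
    {n : StrongDual ℝ X} (hn : ∀ y ∈ C ∩ K, n (y - a) ≤ 0) :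
    ∃ k : StrongDual ℝ X, (∀ y ∈ C, (n - k) (y - a) ≤ 0) ∧ ∀ y ∈ K, k (y - a) ≤ 0 := by
  -- the hypograph of `n (· - a)` over `C` is separated from `interior K × (0, ∞)`
  have hVc : Convex ℝ {p : X × ℝ | p.1 ∈ C ∧ p.2 ≤ n (p.1 - a)} := by
    rintro ⟨x, r⟩ ⟨hx, hr⟩ ⟨y, s⟩ ⟨hy, hs⟩ p q hp hq hpq
    refine ⟨hC hx hy hp hq hpq, ?_⟩
    simp only [Prod.smul_mk, Prod.mk_add_mk, smul_eq_mul] at hr hs ⊢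
    have h1 : p • x + q • y - a = p • (x - a) + q • (y - a) := by
      rw [smul_sub, smul_sub, sub_add_sub_comm, ← add_smul, hpq, one_smul]
    rw [h1, map_add, map_smul, map_smul, smul_eq_mul, smul_eq_mul]
    exact add_le_add (mul_le_mul_of_nonneg_left hr hp) (mul_le_mul_of_nonneg_left hs hq)
  have hUc : Convex ℝ {p : X × ℝ | p.1 ∈ interior K ∧ 0 < p.2} :=
    hK.interior.prod (convex_Ioi (0 : ℝ))
  have hUo : IsOpen {p : X × ℝ | p.1 ∈ interior K ∧ 0 < p.2} :=
    (isOpen_interior.preimage continuous_fst).inter (isOpen_lt continuous_const continuous_snd)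
  have hdisj : Disjoint {p : X × ℝ | p.1 ∈ interior K ∧ 0 < p.2}
      {p : X × ℝ | p.1 ∈ C ∧ p.2 ≤ n (p.1 - a)} := by
    rw [Set.disjoint_left]
    rintro ⟨x, r⟩ ⟨hx, hr⟩ ⟨hx', hr'⟩
    have := hn x ⟨hx', interior_subset hx⟩
    simp only at hr hr'
    linarith
  obtain ⟨f, u, hfU, hfV⟩ := geometric_hahn_banach_open hUc hUo hVc hdisj
  obtain ⟨g, α, hf⟩ := exists_dual_prod_eq f
  have hU : ∀ v ∈ interior K, ∀ r : ℝ, 0 < r → g v + r * α < u := fun v hv r hr => by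
    rw [← hf]
    exact hfU (v, r) ⟨hv, hr⟩
  have hV : ∀ v ∈ C, ∀ r ≤ n (v - a), u ≤ g v + r * α := fun v hv r hr => by
    rw [← hf]
    exact hfV (v, r) ⟨hv, hr⟩
  have hαneg : α < 0 := by
    have h1 := hV x₀ hxC _ le_rfl
    have h4 := hn x₀ ⟨hxC, interior_subset hxK⟩
    by_contra! h3
    have := hU x₀ hxK 1 one_pos
    nlinarith
  have hint : ∀ y ∈ interior K, g y ≤ u := by
    intro y hy
    have h2 : Filter.Tendsto (fun r : ℝ => g y + r * α) (nhdsWithin 0 (Ioi 0))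
        (nhds (g y + 0 * α)) :=
      Filter.Tendsto.mono_left (Continuous.tendsto (by fun_prop) 0) nhdsWithin_le_nhds
    rw [zero_mul, add_zero] at h2
    exact le_of_tendsto h2 (eventually_nhdsWithin_of_forall fun r hr => (hU y hy r hr).le)
  have hKle : ∀ y ∈ K, g y ≤ u := by
    intro y hy
    have h1 : y ∈ closure (interior K) := by
      rw [hK.closure_interior_eq_closure_of_nonempty_interior ⟨x₀, hxK⟩]
      exact subset_closure hy
    have hcl : IsClosed {y : X | g y ≤ u} := isClosed_le (by fun_prop) (by fun_prop)
    exact closure_minimal (fun y hy => hint y hy) hcl h1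
  have hau : g a = u := by
    have h1 := hV a haC 0 (by simp)
    exact le_antisymm (hKle a haK) (by linarith)
  refine ⟨(-α)⁻¹ • g, fun y hy => ?_, fun y hy => ?_⟩
  · have h1 := hV y hy _ le_rfl
    rw [sub_apply, smul_apply, smul_eq_mul, map_sub g, hau]
    have h2 : 0 ≤ (-α)⁻¹ * (g y - u - n (y - a) * (-α)) :=
      mul_nonneg (inv_nonneg.2 (by linarith)) (by linarith)
    have h3 : (-α)⁻¹ * (n (y - a) * (-α)) = n (y - a) := by
      rw [mul_comm (n (y - a)), inv_mul_cancel_left₀ (by linarith)]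
    rw [mul_sub, h3] at h2
    linarith
  · rw [smul_apply, smul_eq_mul, map_sub, hau]
    exact mul_nonpos_of_nonneg_of_nonpos (inv_nonneg.2 (by linarith)) (by linarith [hKle y hy])

/-! ### Cones over balls -/

/-- A description of the cone without division by the parameter, closed under limits at the apex. -/
theorem mem_coneHull_closedBall {ξ x₀ w : X} {ε : ℝ} (hε : 0 ≤ ε) :
    w ∈ coneHull ξ (closedBall x₀ ε) ↔
      ∃ t : ℝ, 0 ≤ t ∧ t ≤ 1 ∧ ‖w - ξ - t • (x₀ - ξ)‖ ≤ t * ε := by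
  constructor
  · rintro ⟨t, h0, h1, a, ha, rfl⟩
    refine ⟨t, h0, h1, ?_⟩
    rw [show (1 - t) • ξ + t • a - ξ - t • (x₀ - ξ) = t • (a - x₀) by module, norm_smul,
      Real.norm_of_nonneg h0]
    exact mul_le_mul_of_nonneg_left (mem_closedBall_iff_norm.1 ha) h0
  · rintro ⟨t, h0, h1, h⟩
    rcases h0.eq_or_lt with rfl | h0'
    · simp only [zero_smul, sub_zero, zero_mul] at h
      refine ⟨0, le_rfl, zero_le_one, x₀, mem_closedBall_self hε, ?_⟩
      have : w - ξ = 0 := norm_le_zero_iff.1 h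
      simp [sub_eq_zero.1 this]
    · refine ⟨t, h0, h1, ξ + t⁻¹ • (w - ξ), ?_, ?_⟩
      · rw [mem_closedBall_iff_norm, show ξ + t⁻¹ • (w - ξ) - x₀ =
          t⁻¹ • (w - ξ - t • (x₀ - ξ)) by
            rw [smul_sub t⁻¹ (w - ξ), inv_smul_smul₀ h0'.ne']; abel, norm_smul,
          Real.norm_of_nonneg (inv_nonneg.2 h0), inv_mul_le_iff₀ h0']
        exact h
      · rw [smul_add, smul_inv_smul₀ h0'.ne']
        module

theorem convex_coneHull_closedBall {ξ x₀ : X} {ε : ℝ} (hε : 0 ≤ ε) :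
    Convex ℝ (coneHull ξ (closedBall x₀ ε)) := by
  intro x hx y hy p q hp hq hpq
  rw [mem_coneHull_closedBall hε] at hx hy ⊢
  obtain ⟨t, h0, h1, h⟩ := hx
  obtain ⟨t', h0', h1', h'⟩ := hy
  refine ⟨p * t + q * t', by positivity, ?_, ?_⟩
  · nlinarith
  · have hξ : ξ = p • ξ + q • ξ := by rw [← add_smul, hpq, one_smul]
    have h2 : p • x + q • y - ξ - (p * t + q * t') • (x₀ - ξ)
        = p • (x - ξ - t • (x₀ - ξ)) + q • (y - ξ - t' • (x₀ - ξ)) := by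
      nth_rewrite 1 [hξ]
      module
    rw [h2]
    refine (norm_add_le _ _).trans ?_
    rw [norm_smul, norm_smul, Real.norm_of_nonneg hp, Real.norm_of_nonneg hq]
    nlinarith [mul_le_mul_of_nonneg_left h hp, mul_le_mul_of_nonneg_left h' hq]

theorem isClosed_coneHull_closedBall {ξ x₀ : X} {ε : ℝ} (hε : 0 ≤ ε) :
    IsClosed (coneHull ξ (closedBall x₀ ε)) := by
  have h1 : IsClosed {p : X × Icc (0 : ℝ) 1 |
      ‖p.1 - ξ - (p.2 : ℝ) • (x₀ - ξ)‖ ≤ (p.2 : ℝ) * ε} :=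
    isClosed_le (by fun_prop) (by fun_prop)
  convert isClosedMap_fst_of_compactSpace _ h1 using 1
  ext w
  rw [mem_coneHull_closedBall hε]
  constructor
  · rintro ⟨t, h0, h1, h⟩
    exact ⟨(w, ⟨t, h0, h1⟩), h, rfl⟩
  · rintro ⟨⟨w, t, h0, h1⟩, h, rfl⟩
    exact ⟨t, h0, h1, h⟩

theorem mem_interior_coneHull_closedBall {ξ x₀ : X} {ε : ℝ} (hε : 0 < ε) :
    x₀ ∈ interior (coneHull ξ (closedBall x₀ ε)) := by
  refine mem_interior.2 ⟨ball x₀ ε, fun w hw => ?_, isOpen_ball, mem_ball_self hε⟩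
  exact ⟨1, zero_le_one, le_rfl, w, ball_subset_closedBall hw, by simp⟩

/-- On a thin cone with apex `ξ`, a functional norming the axis is comparable to the distance to
`ξ`. -/
theorem norm_sub_le_of_mem_coneHull {ξ x₀ w : X} {ε : ℝ} (hε : 0 ≤ ε) (hε' : ε ≤ ‖x₀ - ξ‖ / 2)
    (hw : w ∈ coneHull ξ (closedBall x₀ ε)) {j : StrongDual ℝ X} (hj : ‖j‖ ≤ 1)
    (hjx : j (x₀ - ξ) = ‖x₀ - ξ‖) : ‖w - ξ‖ ≤ 4 * j (w - ξ) := by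
  obtain ⟨t, h0, -, h⟩ := (mem_coneHull_closedBall hε).1 hw
  set e := w - ξ - t • (x₀ - ξ) with he
  have hwe : w - ξ = t • (x₀ - ξ) + e := by rw [he]; abel
  have h1 : ‖w - ξ‖ ≤ t * ‖x₀ - ξ‖ + ‖e‖ := by
    rw [hwe]
    refine (norm_add_le _ _).trans ?_
    rw [norm_smul, Real.norm_of_nonneg h0]
  have h2 : |j e| ≤ ‖e‖ := by
    simpa using j.le_of_opNorm_le hj e
  have h3 : j (w - ξ) = t * ‖x₀ - ξ‖ + j e := by
    rw [hwe, map_add, map_smul, hjx, smul_eq_mul]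
  have h4 : t * ε ≤ t * (‖x₀ - ξ‖ / 2) := mul_le_mul_of_nonneg_left hε' h0
  have h5 : 0 ≤ t * ‖x₀ - ξ‖ := by positivity
  have := neg_le_of_abs_le h2
  linarith

/-! ### The range condition -/

/-- The range condition behind the sum theorem: for all `ξ`, `τ` and every slope `M`, the operator
`T + S - τ` takes a value at some `a` that decreases at rate `M` in the direction `a - ξ`.
Maximality of `T + ∂I_{C ∩ K}` is applied to a thin cone `K` with apex `ξ` around `x₀`; the normals
to `C` are absorbed by `S`, and those to `K` have the right sign because `ξ ∈ K`. -/
theorem exists_apply_sub_le {x₀ : X} (hS : IsMaximalMonotone S)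
    (hTS : dom T ∩ closure (dom S) ⊆ dom S) (hxT : x₀ ∈ dom T) (hdir : DirInfBoundedAt S x₀)
    (hC : Convex ℝ (closure (dom S)))
    (hmax : ∀ K, IsClosed K → Convex ℝ K → x₀ ∈ interior K →
      IsMaximalMonotone (T + subdifferential (indicatorFun (closure (dom S) ∩ K))))
    (ξ : X) (τ : StrongDual ℝ X) {M : ℝ} (hM : 0 ≤ M) :
    ∃ a, ∃ t ∈ T a, ∃ s ∈ S a, (t + s - τ) (a - ξ) ≤ -(M * ‖a - ξ‖) := by
  by_cases hξ : ξ ∈ dom T ∩ dom S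
  · obtain ⟨⟨t, ht⟩, s, hs⟩ := hξ
    exact ⟨ξ, t, ht, s, hs, by simp⟩
  obtain ⟨hxS, hdir'⟩ := hdir
  have hne : 0 < ‖x₀ - ξ‖ := by
    rw [norm_pos_iff, sub_ne_zero]
    rintro rfl
    exact hξ ⟨hxT, hxS⟩
  obtain ⟨ε₀, hε₀, M', hM', hinf⟩ := hdir' ξ
  obtain ⟨j, hj, hjx⟩ := exists_dual_vector'' ℝ (x₀ - ξ)
  simp only [RCLike.ofReal_real_eq_id, id_eq] at hjx
  -- the cone with this radius is thin enough for `norm_sub_le_of_mem_coneHull`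
  set ε := min ε₀ (‖x₀ - ξ‖ / 2) with hεdef
  have hε : 0 < ε := lt_min hε₀ (by linarith)
  set K := coneHull ξ (closedBall x₀ ε) with hK
  have hxK : x₀ ∈ interior K := mem_interior_coneHull_closedBall hε
  have hKc : Convex ℝ K := convex_coneHull_closedBall hε.le
  have hm := hmax K (isClosed_coneHull_closedBall hε.le) hKc hxK
  have hξK : ξ ∈ K := ⟨0, le_rfl, zero_le_one, x₀, mem_closedBall_self hε.le, by simp⟩
  -- `ξ` lies outside the domain of the constrained sum, so no functional is a value there; the
  -- multiple of `j` beats both the required slope `M` and the bound `M'` on `S`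
  have hnot : τ - (4 * (M + M')) • j ∉
      (T + subdifferential (indicatorFun (closure (dom S) ∩ K))) ξ := by
    rintro ⟨t, ht, n, hn, -⟩
    exact hξ ⟨⟨t, ht⟩, hTS ⟨⟨t, ht⟩, (mem_subdifferential_indicatorFun.1 hn).1.1⟩⟩
  have hex := mt hm.mem_of_forall hnot
  push Not at hex
  obtain ⟨a, -, ⟨t, ht, n, hn, rfl⟩, hlt⟩ := hex
  obtain ⟨⟨haC, haK⟩, hn⟩ := mem_subdifferential_indicatorFun.1 hn
  obtain ⟨k, hk1, hk2⟩ := exists_normal_add_normal hC hKc (subset_closure hxS) hxK haC haK hn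
  have haS : a ∈ dom S := hTS ⟨⟨t, ht⟩, haC⟩
  obtain ⟨s, hs, hsle⟩ := hinf a ⟨by
    obtain ⟨r, h0, h1, b, hb, rfl⟩ := haK
    exact ⟨r, h0, h1, b, closedBall_subset_closedBall (min_le_left _ _) hb, rfl⟩, haS⟩
  refine ⟨a, t, ht, s + (n - k), hS.add_normal_mem hs hk1, ?_⟩
  have h1 := hk2 ξ hξK
  have h2 := norm_sub_le_of_mem_coneHull hε.le (min_le_right _ _) haK hj hjx
  rw [← neg_sub a ξ, map_neg] at h1
  simp only [add_apply, sub_apply, smul_apply, smul_eq_mul] at hlt ⊢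
  nlinarith

/-! ### Upper bounds for the values of an operator -/

/-- The upper cone of `T` at `z`: the pairs `(v, β)` for which every value of `T` satisfies
`t v ≤ κ t (a - z) + β + L ‖a - z‖` with constants `κ, L ≥ 0`. -/
def upperCone (T : X → Set (StrongDual ℝ X)) (z : X) : Set (X × ℝ) :=
  {p | ∃ κ : ℝ, 0 ≤ κ ∧ ∃ L : ℝ, 0 ≤ L ∧
    ∀ a, ∀ t ∈ T a, t p.1 ≤ κ * t (a - z) + p.2 + L * ‖a - z‖}

theorem add_mem_upperCone {z v v' : X} {β β' : ℝ} (h : (v, β) ∈ upperCone T z)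
    (h' : (v', β') ∈ upperCone T z) : (v + v', β + β') ∈ upperCone T z := by
  obtain ⟨κ, hκ, L, hL, h⟩ := h
  obtain ⟨κ', hκ', L', hL', h'⟩ := h'
  refine ⟨κ + κ', by positivity, L + L', by positivity, fun a t ht => ?_⟩
  have h1 := h a t ht
  have h2 := h' a t ht
  simp only [map_add] at h1 h2 ⊢
  linarith

theorem smul_mem_upperCone {z v : X} {β c : ℝ} (hc : 0 ≤ c) (h : (v, β) ∈ upperCone T z) :
    (c • v, c * β) ∈ upperCone T z := by
  obtain ⟨κ, hκ, L, hL, h⟩ := h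
  refine ⟨c * κ, by positivity, c * L, by positivity, fun a t ht => ?_⟩
  have h1 := mul_le_mul_of_nonneg_left (h a t ht) hc
  simp only [map_smul, smul_eq_mul] at h1 ⊢
  linarith

theorem IsMonotone.mem_upperCone (hT : IsMonotone T) (z : X) {b : X} {t : StrongDual ℝ X}
    (ht : t ∈ T b) : (b - z, t (b - z)) ∈ upperCone T z := by
  refine ⟨1, zero_le_one, ‖t‖, norm_nonneg _, fun a t' ht' => ?_⟩
  have h1 := hT.apply_le ht' ht
  have h2 := (abs_le.1 (t.le_opNorm (a - z))).1
  have h3 : b - a = (b - z) - (a - z) := by abel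
  rw [h3, map_sub t' (b - z), map_sub t (b - z)] at h1
  simp only
  linarith

/-- The coefficient `κ` of an upper bound can be increased when `z` is in the domain, because then
`t (a - z)` is at least `-‖t₀‖ ‖a - z‖`. -/
theorem IsMonotone.exists_forall_le_of_mem_upperCone (hT : IsMonotone T) {z : X}
    (hz : z ∈ dom T) {v : X} {β : ℝ} (h : (v, β) ∈ upperCone T z) :
    ∃ κ₀ : ℝ, 0 ≤ κ₀ ∧ ∀ κ ≥ κ₀, ∃ L : ℝ, 0 ≤ L ∧
      ∀ a, ∀ t ∈ T a, t v ≤ κ * t (a - z) + β + L * ‖a - z‖ := by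
  obtain ⟨t₀, ht₀⟩ := hz
  obtain ⟨κ₀, hκ₀, L, hL, h⟩ := h
  refine ⟨κ₀, hκ₀, fun κ hκ => ⟨L + (κ - κ₀) * ‖t₀‖, ?_, fun a t ht => ?_⟩⟩
  · have : 0 ≤ κ - κ₀ := by linarith
    positivity
  · have h1 := h a t ht
    have h2 := hT.apply_le ht₀ ht
    have h3 := (abs_le.1 (t₀.le_opNorm (a - z))).1
    have h4 := mul_le_mul_of_nonneg_left (h3.trans h2) (show 0 ≤ κ - κ₀ by linarith)
    simp only at h1
    linarith

/-- A pair related to `T + S` is based in both domains: apply the range condition at `ξ = z`. -/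
theorem mem_dom_inter_of_forall
    (hE : ∀ (ξ : X) (τ : StrongDual ℝ X) (M : ℝ), 0 ≤ M →
      ∃ a, ∃ t ∈ T a, ∃ s ∈ S a, (t + s - τ) (a - ξ) ≤ -(M * ‖a - ξ‖))
    {z : X} {zs : StrongDual ℝ X} (hz : ∀ a, ∀ us ∈ (T + S) a, zs (a - z) ≤ us (a - z)) :
    z ∈ dom T ∩ dom S := by
  obtain ⟨a, t, ht, s, hs, h⟩ := hE z zs 1 zero_le_one
  have h1 := hz a (t + s) (Set.add_mem_add ht hs)
  rw [sub_apply] at h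
  have h2 : a = z := sub_eq_zero.1 (norm_le_zero_iff.1 (by linarith))
  subst h2
  exact ⟨⟨t, ht⟩, s, hs⟩

/-- A pair related to `T + S` is dominated by the sum of upper bounds for `T` and for `S` in a
common direction. The range condition is applied at `z + θ v` with `θ → 0`. -/
theorem apply_le_of_mem_upperCone (hT : IsMonotone T) (hS : IsMonotone S)
    (hE : ∀ (ξ : X) (τ : StrongDual ℝ X) (M : ℝ), 0 ≤ M →
      ∃ a, ∃ t ∈ T a, ∃ s ∈ S a, (t + s - τ) (a - ξ) ≤ -(M * ‖a - ξ‖))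
    {z : X} {zs : StrongDual ℝ X} (hz : ∀ a, ∀ us ∈ (T + S) a, zs (a - z) ≤ us (a - z))
    {v : X} {β₁ β₂ : ℝ} (h₁ : (v, β₁) ∈ upperCone T z) (h₂ : (v, β₂) ∈ upperCone S z) :
    zs v ≤ β₁ + β₂ := by
  obtain ⟨hzT, hzS⟩ := mem_dom_inter_of_forall hE hz
  obtain ⟨κ₁, hκ₁, h₁⟩ := hT.exists_forall_le_of_mem_upperCone hzT h₁
  obtain ⟨κ₂, hκ₂, h₂⟩ := hS.exists_forall_le_of_mem_upperCone hzS h₂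
  set κ := κ₁ + κ₂
  have hκ : 0 ≤ κ := add_nonneg hκ₁ hκ₂
  obtain ⟨L₁, hL₁, h₁⟩ := h₁ κ (by simp [κ, hκ₂])
  obtain ⟨L₂, hL₂, h₂⟩ := h₂ κ (by simp [κ, hκ₁])
  have key : ∀ θ : ℝ, 0 < θ → θ * (κ + 1) < 1 →
      (1 - θ * κ) * zs v ≤ β₁ + β₂ + θ * ((L₁ + L₂) * ‖v‖) := by
    intro θ hθ hθκ
    have hM : 0 ≤ κ * ‖zs‖ + (L₁ + L₂) := by positivity
    obtain ⟨a, t, ht, s, hs, h⟩ := hE (z + θ • v) zs _ hM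
    set e := a - (z + θ • v) with he
    have hd : a - z = θ • v + e := by rw [he]; abel
    have e1 := hz a (t + s) (Set.add_mem_add ht hs)
    have e2 := h₁ a t ht
    have e3 := h₂ a s hs
    have e4 : ‖a - z‖ ≤ θ * ‖v‖ + ‖e‖ := by
      rw [hd]
      refine (norm_add_le _ _).trans ?_
      rw [norm_smul, Real.norm_of_nonneg hθ.le]
    have e5 := (abs_le.1 (zs.le_opNorm e)).2
    rw [hd] at e1 e2 e3
    simp only [map_add, map_smul, smul_eq_mul, add_apply, sub_apply] at h e1 e2 e3
    rw [← hd] at e2 e3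
    -- eliminate `t + s` using its lower bound along `a - z`
    have f1 := mul_le_mul_of_nonneg_left e4 (add_nonneg hL₁ hL₂)
    have f2 : (t v + s v) ≤ κ * (θ * (t v + s v) + (t e + s e)) + (β₁ + β₂)
        + (L₁ + L₂) * (θ * ‖v‖ + ‖e‖) := by linarith
    have hc : 0 ≤ 1 - θ * κ := by nlinarith
    have f3 := mul_le_mul_of_nonneg_left e1 hc
    have f4 := mul_le_mul_of_nonneg_left f2 hθ.le
    have f5 : θ * κ * zs e ≤ θ * κ * (‖zs‖ * ‖e‖) :=
      mul_le_mul_of_nonneg_left e5 (by positivity)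
    have f6 : θ * ((κ * ‖zs‖ + (L₁ + L₂)) * ‖e‖) ≤ (κ * ‖zs‖ + (L₁ + L₂)) * ‖e‖ := by
      have : 0 ≤ (κ * ‖zs‖ + (L₁ + L₂)) * ‖e‖ := by positivity
      nlinarith
    have f7 : θ * ((1 - θ * κ) * zs v) ≤ θ * (β₁ + β₂ + θ * ((L₁ + L₂) * ‖v‖)) := by
      linarith
    exact le_of_mul_le_mul_left f7 hθ
  have hl : Filter.Tendsto (fun θ : ℝ => (1 - θ * κ) * zs v) (nhdsWithin 0 (Ioi 0))
      (nhds ((1 - 0 * κ) * zs v)) :=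
    Filter.Tendsto.mono_left (Continuous.tendsto (by fun_prop) 0) nhdsWithin_le_nhds
  have hr : Filter.Tendsto (fun θ : ℝ => β₁ + β₂ + θ * ((L₁ + L₂) * ‖v‖)) (nhdsWithin 0 (Ioi 0))
      (nhds (β₁ + β₂ + 0 * ((L₁ + L₂) * ‖v‖))) :=
    Filter.Tendsto.mono_left (Continuous.tendsto (by fun_prop) 0) nhdsWithin_le_nhds
  have hev : ∀ᶠ θ : ℝ in nhdsWithin 0 (Ioi 0), θ * (κ + 1) < 1 := by
    have : Filter.Tendsto (fun θ : ℝ => θ * (κ + 1)) (nhdsWithin 0 (Ioi 0)) (nhds (0 * (κ + 1))) :=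
      Filter.Tendsto.mono_left (Continuous.tendsto (by fun_prop) 0) nhdsWithin_le_nhds
    rw [zero_mul] at this
    exact this.eventually (gt_mem_nhds one_pos)
  have := le_of_tendsto_of_tendsto hl hr (by
    filter_upwards [hev, self_mem_nhdsWithin] with θ h h0 using key θ h0 h)
  simpa using this

/-! ### Uniform bounds from directional inf boundedness -/

theorem le_on_closure_inter_closedBall {V : Type*} [NormedAddCommGroup V] {D : Set V}
    {x₀ : V} {ε r : ℝ} (hε : 0 < ε) {f : V → ℝ} (hf : Continuous f)
    (h : ∀ w ∈ D, ‖w - x₀‖ ≤ ε → f w ≤ r) {c : V} (hc : c ∈ closure D)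
    (hcε : ‖c - x₀‖ ≤ ε / 2) : f c ≤ r := by
  have h1 : c ∈ closure (ball x₀ ε ∩ D) :=
    isOpen_ball.inter_closure ⟨mem_ball_iff_norm.2 (by linarith), hc⟩
  have h2 : IsClosed {c | f c ≤ r} := isClosed_le hf continuous_const
  exact closure_minimal (fun w hw => h w hw.2 (mem_ball_iff_norm.1 hw.1).le) h2 h1

theorem mem_coneHull_of_norm_sub_le {x₀ y w : X} {ε : ℝ} (h : ‖w - x₀‖ ≤ ε) :
    w ∈ coneHull y (closedBall x₀ ε) :=
  ⟨1, zero_le_one, le_rfl, w, mem_closedBall_iff_norm.2 h, by simp⟩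

/-- The values of `S` at finitely many points are bounded above on `closure (dom S)` near `x₀`:
directional inf boundedness is applied with these points as apices. -/
theorem DirInfBoundedAt.exists_forall_le {x₀ : X} (hS : IsMonotone S) (hdir : DirInfBoundedAt S x₀)
    (l : List X) : ∃ ε : ℝ, 0 < ε ∧ ∃ R : ℝ, 0 ≤ R ∧ ∀ w ∈ l, ∀ ws ∈ S w,
      ∀ c ∈ closure (dom S), ‖c - x₀‖ ≤ ε → ws (c - w) ≤ R := by
  induction l with
  | nil => exact ⟨1, one_pos, 0, le_rfl, by simp⟩
  | cons w l ih =>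
    obtain ⟨ε, hε, R, hR, ih⟩ := ih
    obtain ⟨ε', hε', M, hM, h⟩ := hdir.2 w
    refine ⟨min ε (ε' / 2), by positivity, max R (M * (ε' + ‖x₀ - w‖)), le_max_of_le_left hR, ?_⟩
    intro v hv vs hvs c hc hcε
    rcases List.mem_cons.1 hv with rfl | hv
    · refine le_max_of_le_right ?_
      refine le_on_closure_inter_closedBall hε' (f := fun c => vs (c - v)) (by fun_prop) ?_ hc
        (hcε.trans (min_le_right _ _))
      intro z hz hzε
      obtain ⟨zs, hzs, hle⟩ := h z ⟨mem_coneHull_of_norm_sub_le hzε, hz⟩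
      refine (hS.apply_le hvs hzs).trans (hle.trans (mul_le_mul_of_nonneg_left ?_ hM.le))
      calc ‖z - v‖ = ‖(z - x₀) + (x₀ - v)‖ := by congr 1; abel
        _ ≤ ‖z - x₀‖ + ‖x₀ - v‖ := norm_add_le _ _
        _ ≤ _ := by linarith
    · exact le_max_of_le_left (ih v hv vs hvs c hc (hcε.trans (min_le_left _ _)))

theorem IsMonotone.neg_norm_le_apply_sub (hS : IsMonotone S) {x₀ : X} {xs : StrongDual ℝ X}
    (hxs : xs ∈ S x₀) {w : X} {ws : StrongDual ℝ X} (hws : ws ∈ S w) (hw : ‖w - x₀‖ ≤ 1) :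
    -‖xs‖ ≤ ws (w - x₀) := by
  refine le_trans ?_ (hS.apply_le hxs hws)
  have h1 := (abs_le.1 (xs.le_opNorm (w - x₀))).1
  have h2 := mul_le_mul_of_nonneg_left hw (norm_nonneg xs)
  linarith

/-- One stage of the gliding hump argument. If the conclusion of
`DirInfBoundedAt.exists_forall_apply_sub_le` fails, then to finitely many points `w'` of `dom S`
one can add a point `w` near `x₀` and a direction `b` along which `S w` is very large, while every
`S w'` stays bounded along `b`. -/
theorem DirInfBoundedAt.exists_hump {x₀ : X} {xs : StrongDual ℝ X} (hS : IsMonotone S)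
    (hdir : DirInfBoundedAt S x₀) (hxs : xs ∈ S x₀) (hC : Convex ℝ (closure (dom S)))
    (hneg : ∀ η : ℝ, 0 < η → ∀ N : ℝ, 0 ≤ N → ∃ a, ∃ s ∈ S a, ∃ w ∈ dom S, ‖w - x₀‖ ≤ η ∧
      N * (1 + ‖a - x₀‖) < s (w - a))
    (l : List X) (hl : ∀ w' ∈ l, ‖w' - x₀‖ ≤ 1) {η : ℝ} (hη : 0 < η) (hη1 : η ≤ 1) {N : ℝ}
    (hN : 0 ≤ N) :
    ∃ w b : X, ∃ Q : ℝ, 0 ≤ Q ∧ w ∈ dom S ∧ ‖w - x₀‖ ≤ η ∧ ‖b - x₀‖ ≤ 1 ∧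
      (∀ w', ∀ ws ∈ S w', ‖w' - x₀‖ ≤ 1 → -Q ≤ ws (w' - b)) ∧
      (∀ ws ∈ S w, N ≤ ws (w - b)) ∧
      ∀ w' ∈ l, ∀ ws ∈ S w', -(‖xs‖ + 1) ≤ ws (w' - b) := by
  obtain ⟨ε, hε, R, hR, hεR⟩ := hdir.exists_forall_le hS l
  set η' := min η ε with hη'def
  have hη' : 0 < η' := lt_min hη hε
  have hη'1 : η' ≤ 1 := (min_le_left _ _).trans hη1
  -- shrinking the direction by `γ` cancels the bound `R` at the earlier points
  set γ := (1 + R)⁻¹ with hγdef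
  have hγ : 0 < γ := by positivity
  have hγ1 : γ ≤ 1 := inv_le_one_of_one_le₀ (by linarith)
  have hγR : γ * R ≤ 1 := by
    rw [hγdef, inv_mul_le_iff₀ (by positivity)]
    linarith
  -- this lower bound becomes `N + ‖xs‖` after scaling by `τ = γ η' / A`
  obtain ⟨a, s, hs, w, hw, hwη, hlt⟩ := hneg η' hη' ((N + ‖xs‖) / (γ * η')) (by positivity)
  set A := 1 + ‖a - x₀‖ with hA
  have hA1 : 1 ≤ A := by have := norm_nonneg (a - x₀); linarith
  have hApos : 0 < A := by linarith
  set σ := η' / A with hσ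
  have hσ0 : 0 < σ := by positivity
  have hσ1 : σ ≤ 1 := (div_le_one hApos).2 (hη'1.trans hA1)
  have hσA : σ * A = η' := div_mul_cancel₀ _ hApos.ne'
  set b' := x₀ + σ • (a - x₀) with hb'
  have hb'η : ‖b' - x₀‖ ≤ η' := by
    rw [hb', add_sub_cancel_left, norm_smul, Real.norm_of_nonneg hσ0.le, ← hσA]
    exact mul_le_mul_of_nonneg_left (by linarith) hσ0.le
  have hb'C : b' ∈ closure (dom S) := by
    have := hC (subset_closure hdir.1) (subset_closure (show a ∈ dom S from ⟨s, hs⟩))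
      (show 0 ≤ 1 - σ by linarith) hσ0.le (by ring)
    convert this using 1
    rw [hb']
    module
  set τ := γ * σ with hτ
  have hτ0 : 0 < τ := by positivity
  have hτ1 : τ ≤ 1 := mul_le_one₀ hγ1 hσ0.le hσ1
  set b := x₀ + τ • (a - x₀) with hb
  have hbτ : ∀ v : X, v - b = (1 - τ) • (v - x₀) + τ • (v - a) := fun v => by
    rw [hb]; module
  refine ⟨w, b, ‖xs‖ + ‖s‖ * A, by positivity, hw, hwη.trans (min_le_left _ _), ?_, ?_, ?_, ?_⟩
  · have : b - x₀ = γ • (b' - x₀) := by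
      rw [hb, hb', hτ]; module
    rw [this, norm_smul, Real.norm_of_nonneg hγ.le]
    exact mul_le_one₀ hγ1 (norm_nonneg _) (hb'η.trans hη'1)
  · intro w' ws hws hw'
    have h1 := hS.neg_norm_le_apply_sub hxs hws hw'
    have h2 := hS.apply_le hs hws
    have h3 := (abs_le.1 (s.le_opNorm (w' - a))).1
    have h4 : ‖w' - a‖ ≤ A := by
      calc ‖w' - a‖ = ‖(w' - x₀) - (a - x₀)‖ := by congr 1; abel
        _ ≤ ‖w' - x₀‖ + ‖a - x₀‖ := norm_sub_le _ _
        _ ≤ _ := by linarith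
    have h5 := mul_le_mul_of_nonneg_left h4 (norm_nonneg s)
    rw [hbτ, map_add, map_smul, map_smul, smul_eq_mul, smul_eq_mul]
    have h6 := norm_nonneg xs
    have h7 : 0 ≤ ‖s‖ * A := by positivity
    nlinarith
  · intro ws hws
    have h1 := hS.neg_norm_le_apply_sub hxs hws (hwη.trans hη'1)
    have h2 := hS.apply_le hs hws
    rw [hbτ, map_add, map_smul, map_smul, smul_eq_mul, smul_eq_mul]
    have h3 := mul_le_mul_of_nonneg_left (hlt.le.trans h2) hτ0.le
    have h4 : τ * ((N + ‖xs‖) / (γ * η') * A) = N + ‖xs‖ := by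
      rw [← hσA, hτ]; field_simp
    rw [h4] at h3
    have h6 := norm_nonneg xs
    nlinarith
  · intro w' hw' ws hws
    have h1 := hS.neg_norm_le_apply_sub hxs hws (hl w' hw')
    have h2 := hεR w' hw' ws hws b' hb'C (hb'η.trans (min_le_right _ _))
    have h3 : w' - b = (1 - γ) • (w' - x₀) - γ • (b' - w') := by
      rw [hb, hb', hτ]; module
    rw [h3, map_sub, map_smul, map_smul, smul_eq_mul, smul_eq_mul]
    have h6 := norm_nonneg xs
    nlinarith

/-- Uniform bound near a point of directional inf boundedness: the values of `S` are bounded above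
on `closure (dom S)` near `x₀`, with linear growth in the base point. Otherwise the humps of
`DirInfBoundedAt.exists_hump` add up to an apex `y` contradicting directional inf boundedness. -/
theorem DirInfBoundedAt.exists_forall_apply_sub_le [CompleteSpace X] {x₀ : X} (hS : IsMonotone S)
    (hdir : DirInfBoundedAt S x₀) (hC : Convex ℝ (closure (dom S))) :
    ∃ η : ℝ, 0 < η ∧ ∃ N : ℝ, 0 ≤ N ∧ ∀ a, ∀ s ∈ S a, ∀ c ∈ closure (dom S), ‖c - x₀‖ ≤ η →
      s (c - a) ≤ N * (1 + ‖a - x₀‖) := by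
  obtain ⟨xs, hxs⟩ := hdir.1
  suffices h : ∃ η : ℝ, 0 < η ∧ ∃ N : ℝ, 0 ≤ N ∧ ∀ a, ∀ s ∈ S a, ∀ w ∈ dom S, ‖w - x₀‖ ≤ η →
      s (w - a) ≤ N * (1 + ‖a - x₀‖) by
    obtain ⟨η, hη, N, hN, h⟩ := h
    exact ⟨η / 2, by positivity, N, hN, fun a s hs c hc hcη =>
      le_on_closure_inter_closedBall hη (f := fun c => s (c - a)) (by fun_prop)
        (h a s hs) hc hcη⟩
  by_contra! hneg
  -- a hump consists of a point `w`, a direction `b` and a bound `Q`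
  let E := {e : X × X × ℝ // 0 ≤ e.2.2 ∧ e.1 ∈ dom S ∧ ‖e.1 - x₀‖ ≤ 1 ∧ ‖e.2.1 - x₀‖ ≤ 1 ∧
    ∀ w', ∀ ws ∈ S w', ‖w' - x₀‖ ≤ 1 → -e.2.2 ≤ ws (w' - e.2.1)}
  have step : ∀ l : List E, ∃ e : E, ‖e.1.1 - x₀‖ ≤ 1 / ((l.length : ℝ) + 1) ∧
      (∀ ws ∈ S e.1.1, 2 * 2 ^ l.length * (l.length + (l.map fun e => e.1.2.2).sum) ≤
        ws (e.1.1 - e.1.2.1)) ∧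
      ∀ f ∈ l, ∀ ws ∈ S f.1.1, -(‖xs‖ + 1) ≤ ws (f.1.1 - e.1.2.1) := by
    intro l
    have hsum : 0 ≤ (l.map fun e => e.1.2.2).sum := List.sum_nonneg (by
      intro x hx
      obtain ⟨e, -, rfl⟩ := List.mem_map.1 hx
      exact e.2.1)
    have hη1 : 1 / ((l.length : ℝ) + 1) ≤ 1 := by
      rw [div_le_one (by positivity)]
      have : (0 : ℝ) ≤ l.length := by positivity
      linarith
    obtain ⟨w, b, Q, hQ, hw, hwη, hb, h1, h2, h3⟩ := hdir.exists_hump hS hxs hC hneg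
      (l.map fun e => e.1.1) (by
        intro w' hw'
        obtain ⟨e, -, rfl⟩ := List.mem_map.1 hw'
        exact e.2.2.2.1)
      (η := 1 / ((l.length : ℝ) + 1)) (by positivity) hη1
      (N := 2 * 2 ^ l.length * (l.length + (l.map fun e => e.1.2.2).sum)) (by positivity)
    exact ⟨⟨(w, b, Q), hQ, hw, hwη.trans hη1, hb, h1⟩, hwη, h2, fun f hf =>
      h3 _ (List.mem_map.2 ⟨f, hf, rfl⟩)⟩
  choose next hnext using step
  let L : ℕ → List E := fun n => Nat.rec [] (fun _ l => next l :: l) n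
  have hLsucc : ∀ n, L (n + 1) = next (L n) :: L n := fun n => rfl
  have hlen : ∀ n, (L n).length = n := by
    intro n
    induction n with
    | zero => rfl
    | succ n ih => rw [hLsucc, List.length_cons, ih]
  have hmem : ∀ n, ∀ i < n, next (L i) ∈ L n := by
    intro n
    induction n with
    | zero => simp
    | succ n ih =>
      intro i hi
      rw [hLsucc, List.mem_cons]
      rcases Nat.lt_succ_iff_lt_or_eq.1 hi with hi | rfl
      · exact Or.inr (ih i hi)
      · exact Or.inl rfl
  have hsum : ∀ n, ((L n).map fun e => e.1.2.2).sum =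
      ∑ i ∈ Finset.range n, (next (L i)).1.2.2 := by
    intro n
    induction n with
    | zero => rfl
    | succ n ih => rw [hLsucc, List.map_cons, List.sum_cons, ih, Finset.sum_range_succ, add_comm]
  set w : ℕ → X := fun i => (next (L i)).1.1 with hw
  set b : ℕ → X := fun i => (next (L i)).1.2.1 with hb
  set Q : ℕ → ℝ := fun i => (next (L i)).1.2.2 with hQ
  have hwdom : ∀ i, w i ∈ dom S := fun i => (next (L i)).2.2.1
  have hw1 : ∀ i, ‖w i - x₀‖ ≤ 1 := fun i => (next (L i)).2.2.2.1
  have hb1 : ∀ i, ‖b i - x₀‖ ≤ 1 := fun i => (next (L i)).2.2.2.2.1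
  have hQb : ∀ i w', ∀ ws ∈ S w', ‖w' - x₀‖ ≤ 1 → -Q i ≤ ws (w' - b i) :=
    fun i => (next (L i)).2.2.2.2.2
  have hQ0 : ∀ i, 0 ≤ Q i := fun i => (next (L i)).2.1
  have hwi : ∀ i : ℕ, ‖w i - x₀‖ ≤ 1 / ((i : ℝ) + 1) := fun i => by
    simpa [hlen] using (hnext (L i)).1
  have hbig : ∀ i : ℕ, ∀ ws ∈ S (w i),
      2 * 2 ^ i * (i + ∑ j ∈ Finset.range i, Q j) ≤ ws (w i - b i) := fun i => by
    have := (hnext (L i)).2.1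
    rwa [hlen, hsum] at this
  have hlater : ∀ i j, i < j → ∀ ws ∈ S (w i), -(‖xs‖ + 1) ≤ ws (w i - b j) := fun i j hij =>
    (hnext (L j)).2.2 _ (hmem j i hij)
  clear_value w b Q
  set g : ℕ → ℝ := fun n => 1 / 2 / 2 ^ n with hg
  have hg0 : ∀ n, 0 < g n := fun n => by positivity
  have hg1 : ∀ n, g n ≤ 1 := fun n => by
    have : (1 : ℝ) ≤ 2 ^ n := one_le_pow₀ one_le_two
    rw [hg]
    simp only
    rw [div_le_one (by positivity)]
    linarith
  have hgsum : HasSum g 1 := hasSum_geometric_two' 1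
  have hsummable : Summable fun j => g j • (b j - x₀) := by
    refine Summable.of_norm_bounded hgsum.summable fun j => ?_
    rw [norm_smul, Real.norm_of_nonneg (hg0 j).le]
    exact mul_le_of_le_one_right (hg0 j).le (hb1 j)
  obtain ⟨v, hv⟩ := hsummable
  -- the apex `y` averages all directions `b j` with weights `g j`
  set y := x₀ + v with hy
  have hwy : ∀ i, HasSum (fun j => g j • (w i - b j)) (w i - y) := by
    intro i
    have h1 := (hgsum.smul_const (w i - x₀)).sub hv
    convert h1 using 1
    · ext j
      rw [← smul_sub]
      congr 1
      abel
    · rw [hy, one_smul]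
      abel
  have hlow : ∀ i : ℕ, ∀ ws ∈ S (w i), (i : ℝ) ≤ ws (w i - y) + (‖xs‖ + 1) := by
    intro i ws hws
    have h1 : HasSum (fun j => g j * ws (w i - b j) + g j * (‖xs‖ + 1))
        (ws (w i - y) + 1 * (‖xs‖ + 1)) := by
      refine HasSum.add ?_ (hgsum.mul_right _)
      have := (hwy i).mapL ws
      simpa only [map_smul, smul_eq_mul] using this
    rw [one_mul] at h1
    refine le_trans ?_ (sum_le_hasSum (Finset.range (i + 1)) ?_ h1)
    -- the term `i` outweighs the terms below it, and those above `i` are nonnegative after adding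
    -- `g j * (‖xs‖ + 1)`
    · rw [Finset.sum_range_succ]
      have hxs0 : 0 ≤ g i * (‖xs‖ + 1) := mul_nonneg (hg0 i).le (by positivity)
      have h2 : ∑ j ∈ Finset.range i, -Q j ≤
          ∑ j ∈ Finset.range i, (g j * ws (w i - b j) + g j * (‖xs‖ + 1)) := by
        refine Finset.sum_le_sum fun j _ => ?_
        have h3 := mul_le_mul_of_nonneg_left (hQb j (w i) ws hws (hw1 i)) (hg0 j).le
        have h4 : 0 ≤ g j * (‖xs‖ + 1) := mul_nonneg (hg0 j).le (by positivity)
        have h5 := mul_le_mul_of_nonneg_right (hg1 j) (hQ0 j)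
        linarith
      have h3 := mul_le_mul_of_nonneg_left (hbig i ws hws) (hg0 i).le
      have h4 : g i * (2 * 2 ^ i * (i + ∑ j ∈ Finset.range i, Q j)) =
          i + ∑ j ∈ Finset.range i, Q j := by
        rw [hg]; field_simp
      rw [Finset.sum_neg_distrib] at h2
      linarith
    · intro j hj
      rw [Finset.mem_range, not_lt] at hj
      rw [← mul_add]
      refine mul_nonneg (hg0 j).le ?_
      have := hlater i j hj ws hws
      linarith
  obtain ⟨ε, hε, M, hM, hinf⟩ := hdir.2 y
  obtain ⟨i, hi⟩ := exists_nat_gt (max (1 / ε) (M * (1 + ‖x₀ - y‖) + (‖xs‖ + 1)))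
  have hiε : 1 / ((i : ℝ) + 1) ≤ ε := by
    have h1 := (le_max_left _ _).trans_lt hi
    rw [div_lt_iff₀ hε] at h1
    rw [div_le_iff₀ (by positivity)]
    nlinarith
  obtain ⟨ws, hws, hle⟩ := hinf (w i) ⟨mem_coneHull_of_norm_sub_le ((hwi i).trans hiε), hwdom i⟩
  have h1 := hlow i ws hws
  have h2 : ‖w i - y‖ ≤ 1 + ‖x₀ - y‖ := by
    calc ‖w i - y‖ = ‖(w i - x₀) + (x₀ - y)‖ := by congr 1; abel
      _ ≤ ‖w i - x₀‖ + ‖x₀ - y‖ := norm_add_le _ _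
      _ ≤ _ := by linarith [hw1 i]
  have h3 := mul_le_mul_of_nonneg_left h2 hM.le
  have h4 := (le_max_right _ _).trans_lt hi
  linarith

/-! ### Differences of convex sets -/

theorem exists_norm_smul_le (v : X) {δ : ℝ} (hδ : 0 < δ) :
    ∃ σ : ℝ, 0 < σ ∧ σ ≤ 1 ∧ ‖σ • v‖ ≤ δ := by
  refine ⟨δ / (δ + ‖v‖), by positivity,
    div_le_one_of_le₀ (by linarith [norm_nonneg v]) (by positivity), ?_⟩
  rw [norm_smul, Real.norm_of_nonneg (by positivity), div_mul_eq_mul_div,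
    div_le_iff₀ (by positivity)]
  nlinarith [norm_nonneg v]

theorem sum_half_pow_smul_add_mem {A : Set X} (hA : Convex ℝ A) {a : ℕ → X} (ha : ∀ k, a k ∈ A)
    (n : ℕ) {z : X} (hz : z ∈ A) :
    ∑ k ∈ Finset.range n, (1 / 2 : ℝ) ^ (k + 1) • a k + (1 / 2 : ℝ) ^ n • z ∈ A := by
  induction n generalizing z with
  | zero => simpa using hz
  | succ n ih =>
    have h1 : (1 / 2 : ℝ) • a n + (1 / 2 : ℝ) • z ∈ A :=
      hA (ha n) hz (by norm_num) (by norm_num) (by norm_num)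
    have h2 := ih h1
    rw [Finset.sum_range_succ]
    convert h2 using 1
    module

/-- A closed convex bounded set is stable under infinite convex combinations. -/
theorem exists_tendsto_sum_half_pow_smul [CompleteSpace X] {A : Set X} (hA : Convex ℝ A)
    (hcl : IsClosed A) {x₀ : X} {R : ℝ} (hR : ∀ e ∈ A, ‖e - x₀‖ ≤ R) {a : ℕ → X}
    (ha : ∀ k, a k ∈ A) :
    ∃ e ∈ A, Filter.Tendsto (fun n => ∑ k ∈ Finset.range n, (1 / 2 : ℝ) ^ (k + 1) • a k)
      Filter.atTop (nhds e) := by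
  have hR' : ∀ k, ‖a k‖ ≤ R + ‖x₀‖ := fun k => by
    have h1 := hR _ (ha k)
    have h2 := norm_le_norm_add_norm_sub' (a k) x₀
    linarith
  have hsum : Summable fun k => (1 / 2 : ℝ) ^ (k + 1) • a k := by
    refine Summable.of_norm_bounded (g := fun k => (1 / 2 : ℝ) ^ k * (R + ‖x₀‖))
      (summable_geometric_two.mul_right _) fun k => ?_
    rw [norm_smul, Real.norm_of_nonneg (by positivity)]
    have h0 : (0 : ℝ) ≤ R + ‖x₀‖ := (norm_nonneg _).trans (hR' k)
    refine mul_le_mul ?_ (hR' k) (norm_nonneg _) (by positivity)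
    exact pow_le_pow_of_le_one (by norm_num) (by norm_num) (Nat.le_succ k)
  obtain ⟨e, he⟩ := hsum
  refine ⟨e, ?_, he.tendsto_sum_nat⟩
  have h1 : Filter.Tendsto (fun n => ∑ k ∈ Finset.range n, (1 / 2 : ℝ) ^ (k + 1) • a k
      + (1 / 2 : ℝ) ^ n • a 0) Filter.atTop (nhds (e + (0 : ℝ) • a 0)) :=
    he.tendsto_sum_nat.add
      ((tendsto_pow_atTop_nhds_zero_of_lt_one (by norm_num) (by norm_num)).smul_const _)
  rw [zero_smul, add_zero] at h1
  exact hcl.mem_of_tendsto h1 (Filter.Eventually.of_forall fun n =>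
    sum_half_pow_smul_add_mem hA ha n (ha 0))

/-- An open mapping theorem for differences of convex sets, in the style of Robinson and Ursescu:
Baire's theorem gives a ball in the closure of `A n - B`, and the closure is removed by
successive approximation. -/
theorem exists_forall_norm_le_eq_sub [CompleteSpace X] {Y : Submodule ℝ X}
    (hY : IsClosed (Y : Set X))
    {A : ℕ → Set X} {B : Set X} {x₀ : X} (hA : Monotone A) (hAcl : ∀ n, IsClosed (A n))
    (hAc : ∀ n, Convex ℝ (A n)) (hBcl : IsClosed B) (hBc : Convex ℝ B)
    (hAb : ∀ n, ∃ R, ∀ e ∈ A n, ‖e - x₀‖ ≤ R) (hBb : ∃ R, ∀ c ∈ B, ‖c - x₀‖ ≤ R)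
    (hxA : ∀ n, x₀ ∈ A n) (hxB : x₀ ∈ B) (hAY : ∀ n, ∀ e ∈ A n, e - x₀ ∈ Y)
    (hBY : ∀ c ∈ B, c - x₀ ∈ Y)
    (hcov : ∀ p ∈ Y, ∃ m : ℝ, 0 < m ∧ ∃ n, ∃ e ∈ A n, ∃ c ∈ B, p = m • (e - c)) :
    ∃ ρ : ℝ, 0 < ρ ∧ ∃ n, ∀ p ∈ Y, ‖p‖ ≤ ρ → ∃ e ∈ A n, ∃ c ∈ B, p = e - c := by
  have : CompleteSpace Y := hY.completeSpace_coe
  have hDc : ∀ n, Convex ℝ (closure (A n - B)) := fun n => ((hAc n).sub hBc).closure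
  have hD0 : ∀ n, (0 : X) ∈ closure (A n - B) := fun n =>
    subset_closure ⟨x₀, hxA n, x₀, hxB, sub_self _⟩
  have hDm : ∀ {i k}, i ≤ k → closure (A i - B) ⊆ closure (A k - B) := fun h =>
    closure_mono (Set.sub_subset_sub_right (hA h))
  have hscale : ∀ {i k : ℕ} {q : X}, i ≤ k → ((i : ℝ) + 1)⁻¹ • q ∈ closure (A i - B) →
      ((k : ℝ) + 1)⁻¹ • q ∈ closure (A k - B) := by
    intro i k q hik hq
    have h0 : (i : ℝ) ≤ k := by exact_mod_cast hik
    have h1 := (hDc k).smul_mem_of_zero_mem (hD0 k) (hDm hik hq)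
      (t := ((i : ℝ) + 1) / ((k : ℝ) + 1))
      ⟨by positivity, (div_le_one (by positivity)).2 (by linarith)⟩
    convert h1 using 1
    rw [smul_smul]
    congr 1
    field_simp
  have hex : ∀ p ∈ Y, ∃ k : ℕ, ((k : ℝ) + 1)⁻¹ • p ∈ closure (A k - B) := by
    intro p hp
    obtain ⟨m, hm, n, e, he, c, hc, rfl⟩ := hcov p hp
    obtain ⟨k, hk⟩ := exists_nat_ge m
    refine ⟨max n k, ?_⟩
    have h0 : (k : ℝ) ≤ (max n k : ℕ) := by exact_mod_cast le_max_right n k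
    rw [smul_smul]
    refine (hDc _).smul_mem_of_zero_mem (hD0 _)
      (hDm (le_max_left n k) (subset_closure ⟨e, he, c, hc, rfl⟩)) ⟨by positivity, ?_⟩
    rw [inv_mul_le_iff₀ (by positivity)]
    linarith
  obtain ⟨k, p₀, hp₀⟩ := nonempty_interior_of_iUnion_of_closed
    (f := fun k : ℕ => {p : Y | ((k : ℝ) + 1)⁻¹ • (p : X) ∈ closure (A k - B)})
    (fun k => isClosed_closure.preimage (by fun_prop)) (by
      ext p
      simpa using hex p p.2)
  obtain ⟨δ, hδ, hball⟩ := Metric.isOpen_iff.1 isOpen_interior p₀ hp₀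
  obtain ⟨l, hl⟩ := hex _ (Y.neg_mem p₀.2)
  set n := max k l
  have hn : (0 : ℝ) < (n : ℝ) + 1 := by positivity
  -- the ball around `p₀` is recentred at the origin by averaging with `-p₀`
  have hcl : ∀ q ∈ Y, ‖q‖ ≤ δ / 3 / ((n : ℝ) + 1) → q ∈ closure (A n - B) := by
    intro q hq hqn
    rw [le_div_iff₀ hn] at hqn
    have h1 : p₀ + (2 * ((n : ℝ) + 1)) • (⟨q, hq⟩ : Y) ∈ ball p₀ δ := by
      rw [mem_ball_iff_norm, add_sub_cancel_left, norm_smul, Real.norm_of_nonneg (by positivity)]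
      have : ‖(⟨q, hq⟩ : Y)‖ = ‖q‖ := rfl
      rw [this]
      linarith
    have h2 : ((k : ℝ) + 1)⁻¹ • ((p₀ + (2 * ((n : ℝ) + 1)) • (⟨q, hq⟩ : Y) : Y) : X) ∈
        closure (A k - B) := by
      have := interior_subset (hball h1)
      exact this
    replace h2 := hscale (le_max_left k l) h2
    have h3 := hscale (le_max_right k l) hl
    have h4 := hDc n h2 h3 (show (0 : ℝ) ≤ 1 / 2 by norm_num) (show (0 : ℝ) ≤ 1 / 2 by norm_num)
      (by norm_num)
    convert h4 using 1
    simp only [Submodule.coe_add, Submodule.coe_smul, smul_add, smul_neg, smul_smul]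
    have : 1 / 2 * (((n : ℝ) + 1)⁻¹ * (2 * ((n : ℝ) + 1))) = 1 := by field_simp
    rw [this, one_smul]
    abel
  set ρ := δ / 3 / ((n : ℝ) + 1) with hρdef
  have hρ : 0 < ρ := by positivity
  have happrox : ∀ p : X, p ∈ Y → ‖p‖ ≤ ρ / 2 →
      ∃ e ∈ A n, ∃ c ∈ B, ‖(2 : ℝ) • p - (e - c)‖ ≤ ρ / 2 := by
    intro p hp hpn
    have h1 := hcl _ (Y.smul_mem 2 hp) (by
      rw [norm_smul, Real.norm_of_nonneg zero_le_two]
      linarith)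
    obtain ⟨_, ⟨e, he, c, hc, rfl⟩, hd⟩ := Metric.mem_closure_iff.1 h1 (ρ / 2) (by positivity)
    exact ⟨e, he, c, hc, by rw [← dist_eq_norm]; exact hd.le⟩
  choose! e he c hc hec using happrox
  refine ⟨ρ / 2, by positivity, n, fun p hp hpn => ?_⟩
  let P : ℕ → X := fun k => Nat.rec p (fun _ q => (2 : ℝ) • q - (e q - c q)) k
  have hPs : ∀ k, P (k + 1) = (2 : ℝ) • P k - (e (P k) - c (P k)) := fun k => rfl
  have hP : ∀ k, P k ∈ Y ∧ ‖P k‖ ≤ ρ / 2 := by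
    intro k
    induction k with
    | zero => exact ⟨hp, hpn⟩
    | succ k ih =>
      refine ⟨?_, hec _ ih.1 ih.2⟩
      rw [hPs, show e (P k) - c (P k) = (e (P k) - x₀) - (c (P k) - x₀) by abel]
      exact Y.sub_mem (Y.smul_mem _ ih.1)
        (Y.sub_mem (hAY n _ (he _ ih.1 ih.2)) (hBY _ (hc _ ih.1 ih.2)))
  have hpart : ∀ k, ∑ i ∈ Finset.range k, (1 / 2 : ℝ) ^ (i + 1) • e (P i)
      - ∑ i ∈ Finset.range k, (1 / 2 : ℝ) ^ (i + 1) • c (P i) + (1 / 2 : ℝ) ^ k • P k = p := by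
    intro k
    induction k with
    | zero => simp [P]
    | succ k ih =>
      refine Eq.trans ?_ ih
      rw [Finset.sum_range_succ, Finset.sum_range_succ, hPs]
      module
  obtain ⟨R, hR⟩ := hAb n
  obtain ⟨R', hR'⟩ := hBb
  obtain ⟨x, hx, hxt⟩ := exists_tendsto_sum_half_pow_smul (hAc n) (hAcl n) hR
    fun k => he _ (hP k).1 (hP k).2
  obtain ⟨x', hx', hxt'⟩ := exists_tendsto_sum_half_pow_smul hBc hBcl hR'
    fun k => hc _ (hP k).1 (hP k).2
  refine ⟨x, hx, x', hx', ?_⟩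
  have hres : Filter.Tendsto (fun k => (1 / 2 : ℝ) ^ k • P k) Filter.atTop (nhds 0) := by
    have h1 : Filter.Tendsto (fun k : ℕ => (1 / 2 : ℝ) ^ k * (ρ / 2)) Filter.atTop
        (nhds (0 * (ρ / 2))) :=
      (tendsto_pow_atTop_nhds_zero_of_lt_one (by norm_num) (by norm_num)).mul_const _
    rw [zero_mul] at h1
    refine squeeze_zero_norm (fun k => ?_) h1
    rw [norm_smul, Real.norm_of_nonneg (by positivity)]
    exact mul_le_mul_of_nonneg_left (hP k).2 (by positivity)
  have h1 := (hxt.sub hxt').add hres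
  rw [add_zero] at h1
  exact tendsto_nhds_unique (tendsto_const_nhds.congr fun k => (hpart k).symm) h1

/-! ### The sum theorem under a closed subspace condition -/

theorem mem_upperCone_of_forall_le {x₀ e : X} {N : ℝ} (hN : 0 ≤ N)
    (h : ∀ a, ∀ t ∈ T a, t (e - a) ≤ N * (1 + ‖a - x₀‖)) (z : X) :
    (e - z, N * (1 + ‖z - x₀‖)) ∈ upperCone T z := by
  refine ⟨1, zero_le_one, N, hN, fun a t ht => ?_⟩
  have h1 := h a t ht
  have h2 : ‖a - x₀‖ ≤ ‖a - z‖ + ‖z - x₀‖ := norm_sub_le_norm_sub_add_norm_sub a z x₀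
  have h3 : e - z = (e - a) + (a - z) := by abel
  have h4 := mul_le_mul_of_nonneg_left h2 hN
  simp only
  rw [h3, map_add]
  linarith

/-- The points `e` of `x₀ + Y` at which the values of `T` are bounded above with constant `r`. -/
def boundedPoints (T : X → Set (StrongDual ℝ X)) (Y : Submodule ℝ X) (x₀ : X) (r : ℝ) : Set X :=
  {e | e - x₀ ∈ Y ∧ ‖e - x₀‖ ≤ r ∧ ∀ a, ∀ t ∈ T a, t (e - a) ≤ r * (1 + ‖a - x₀‖)}

theorem boundedPoints_mono {Y : Submodule ℝ X} {x₀ : X} :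
    Monotone (boundedPoints T Y x₀) := fun r r' hr e ⟨h1, h2, h3⟩ =>
  ⟨h1, h2.trans hr, fun a t ht => (h3 a t ht).trans
    (mul_le_mul_of_nonneg_right hr (by positivity))⟩

theorem isClosed_boundedPoints {Y : Submodule ℝ X} (hY : IsClosed (Y : Set X)) {x₀ : X} {r : ℝ} :
    IsClosed (boundedPoints T Y x₀ r) := by
  have h1 : IsClosed {e : X | e - x₀ ∈ Y} :=
    hY.preimage (f := fun e => e - x₀) (by fun_prop)
  have h2 : IsClosed {e : X | ‖e - x₀‖ ≤ r} := isClosed_le (by fun_prop) continuous_const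
  have h3 : IsClosed {e : X | ∀ a, ∀ t ∈ T a, t (e - a) ≤ r * (1 + ‖a - x₀‖)} := by
    simp only [ofPred_forall]
    exact isClosed_iInter fun a => isClosed_iInter fun t => isClosed_iInter fun _ =>
      isClosed_le (by fun_prop) continuous_const
  exact h1.inter (h2.inter h3)

theorem convex_boundedPoints {Y : Submodule ℝ X} {x₀ : X} {r : ℝ} :
    Convex ℝ (boundedPoints T Y x₀ r) := by
  rintro e ⟨h1, h2, h3⟩ e' ⟨h1', h2', h3'⟩ p q hp hq hpq
  have key : ∀ b : X, p • e + q • e' - b = p • (e - b) + q • (e' - b) := fun b => by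
    rw [smul_sub, smul_sub, sub_add_sub_comm, ← add_smul, hpq, one_smul]
  refine ⟨?_, ?_, fun a t ht => ?_⟩
  · rw [key]
    exact Y.add_mem (Y.smul_mem _ h1) (Y.smul_mem _ h1')
  · rw [key]
    refine (norm_add_le _ _).trans ?_
    rw [norm_smul, norm_smul, Real.norm_of_nonneg hp, Real.norm_of_nonneg hq]
    have h4 : (p + q) * r = r := by rw [hpq, one_mul]
    linarith [mul_le_mul_of_nonneg_left h2 hp, mul_le_mul_of_nonneg_left h2' hq]
  · rw [key, map_add, map_smul, map_smul, smul_eq_mul, smul_eq_mul]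
    have := mul_le_mul_of_nonneg_left (h3 a t ht) hp
    have := mul_le_mul_of_nonneg_left (h3' a t ht) hq
    have : (p + q) * (r * (1 + ‖a - x₀‖)) = r * (1 + ‖a - x₀‖) := by rw [hpq, one_mul]
    linarith

theorem IsMonotone.mem_boundedPoints (hT : IsMonotone T) {Y : Submodule ℝ X} {x₀ e : X}
    {es : StrongDual ℝ X} (hes : es ∈ T e) (heY : e - x₀ ∈ Y) {r : ℝ} (hr : ‖e - x₀‖ ≤ r)
    (hr' : ‖es‖ * (1 + ‖e - x₀‖) ≤ r) : e ∈ boundedPoints T Y x₀ r := by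
  refine ⟨heY, hr, fun a t ht => ?_⟩
  have h1 := hT.apply_le ht hes
  have h2 := (abs_le.1 (es.le_opNorm (e - a))).2
  have h3 : ‖e - a‖ ≤ ‖e - x₀‖ + ‖a - x₀‖ := by
    rw [show e - a = (e - x₀) - (a - x₀) by abel]
    exact norm_sub_le _ _
  calc t (e - a) ≤ ‖es‖ * ‖e - a‖ := h1.trans h2
    _ ≤ ‖es‖ * ((1 + ‖e - x₀‖) * (1 + ‖a - x₀‖)) := by
      refine mul_le_mul_of_nonneg_left (h3.trans ?_) (norm_nonneg _)
      nlinarith [norm_nonneg (e - x₀), norm_nonneg (a - x₀)]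
    _ = ‖es‖ * (1 + ‖e - x₀‖) * (1 + ‖a - x₀‖) := by ring
    _ ≤ r * (1 + ‖a - x₀‖) := mul_le_mul_of_nonneg_right hr' (by positivity)

/-- The constraint qualification turned into a quantitative statement: small vectors of `Y` are
differences of points at which `T` is uniformly bounded and points of `C` close to `x₀`. -/
theorem IsMonotone.exists_forall_eq_sub [CompleteSpace X] (hT : IsMonotone T) {x₀ : X}
    (hxT : x₀ ∈ dom T) {C : Set X} (hCcl : IsClosed C) (hCc : Convex ℝ C) (hxC : x₀ ∈ C)
    {Y : Submodule ℝ X} (hYcl : IsClosed (Y : Set X))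
    (hY : (Y : Set X) = ⋃ (r : ℝ) (_ : 0 < r), r • (convexHull ℝ (dom T) - C))
    (hYmem : ∀ a ∈ dom T, ∀ c ∈ C, a - c ∈ Y) {η : ℝ} (hη : 0 < η) :
    ∃ ρ : ℝ, 0 < ρ ∧ ∃ N : ℝ, 0 ≤ N ∧ ∀ p ∈ Y, ‖p‖ ≤ ρ → ∃ e, ∃ c ∈ C,
      (∀ a, ∀ t ∈ T a, t (e - a) ≤ N * (1 + ‖a - x₀‖)) ∧ ‖c - x₀‖ ≤ η ∧ p = e - c := by
  obtain ⟨xs, hxs⟩ := hxT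
  set A : ℕ → Set X := fun n => boundedPoints T Y x₀ (n + ‖xs‖) with hA
  have hAm : Monotone A := fun i k hik => boundedPoints_mono (by
    have : (i : ℝ) ≤ k := by exact_mod_cast hik
    linarith)
  have hAc : ∀ n, Convex ℝ (A n) := fun n => convex_boundedPoints
  have hxA : ∀ n, x₀ ∈ A n := fun n => hT.mem_boundedPoints hxs (by simp)
    (by rw [sub_self, norm_zero]; positivity) (by
      rw [sub_self, norm_zero, add_zero, mul_one]
      have : (0 : ℝ) ≤ n := by positivity
      linarith)
  have hsub : convexHull ℝ (dom T) ⊆ ⋃ n, A n := by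
    refine convexHull_min ?_ (hAm.directed_le.convex_iUnion fun n => hAc n)
    rintro a ⟨t, ht⟩
    obtain ⟨n, hn⟩ := exists_nat_ge (max ‖a - x₀‖ (‖t‖ * (1 + ‖a - x₀‖)))
    have h0 := norm_nonneg xs
    refine mem_iUnion.2 ⟨n, hT.mem_boundedPoints ht (hYmem a ⟨t, ht⟩ x₀ hxC) ?_ ?_⟩
    · linarith [(le_max_left _ _).trans hn]
    · linarith [(le_max_right _ _).trans hn]
  obtain ⟨ρ, hρ, n, h⟩ := exists_forall_norm_le_eq_sub (B := C ∩ closedBall x₀ η) (x₀ := x₀) hYcl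
    hAm (fun n => isClosed_boundedPoints hYcl) hAc (hCcl.inter isClosed_closedBall)
    (hCc.inter (convex_closedBall _ _)) (fun n => ⟨_, fun e he => he.2.1⟩)
    ⟨η, fun c hc => mem_closedBall_iff_norm.1 hc.2⟩ hxA ⟨hxC, mem_closedBall_self hη.le⟩
    (fun n e he => he.1) (fun c hc => by
      rw [← neg_sub]
      exact Y.neg_mem (hYmem x₀ ⟨xs, hxs⟩ c hc.1)) (by
      intro p hp
      rw [← SetLike.mem_coe, hY] at hp
      simp only [mem_iUnion] at hp
      obtain ⟨r, hr, _, ⟨u, hu, c, hc, rfl⟩, rfl⟩ := hp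
      obtain ⟨n, hn⟩ := mem_iUnion.1 (hsub hu)
      -- both points are contracted towards `x₀` to bring `c` within distance `η`
      obtain ⟨σ, hσ0, hσ1, hσ⟩ := exists_norm_smul_le (c - x₀) hη
      refine ⟨r / σ, by positivity, n, (1 - σ) • x₀ + σ • u,
        hAc n (hxA n) hn (by linarith) hσ0.le (by ring), (1 - σ) • x₀ + σ • c,
        ⟨hCc hxC hc (by linarith) hσ0.le (by ring), ?_⟩, ?_⟩
      · rw [mem_closedBall_iff_norm, show (1 - σ) • x₀ + σ • c - x₀ = σ • (c - x₀) by module]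
        exact hσ
      · rw [show (1 - σ) • x₀ + σ • u - ((1 - σ) • x₀ + σ • c) = σ • (u - c) by module,
          smul_smul, div_mul_cancel₀ _ hσ0.ne'])
  refine ⟨ρ, hρ, n + ‖xs‖, by positivity, fun p hp hpρ => ?_⟩
  obtain ⟨e, he, c, hc, rfl⟩ := h p hp hpρ
  exact ⟨e, c, hc.1, he.2.2, mem_closedBall_iff_norm.1 hc.2, rfl⟩

/-- The sum theorem under the qualification `closure (dom S) ∈ C1 T`, when `S` is directionally inf
bounded at `x₀` and the sums of `T` with the normal cones of the sets `closure (dom S) ∩ K`, for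
convex neighbourhoods `K` of `x₀`, are maximal. -/
theorem isMaximalMonotone_add [CompleteSpace X] {x₀ : X} (hT : IsMaximalMonotone T)
    (hS : IsMaximalMonotone S) (hTS : dom T ∩ closure (dom S) ⊆ dom S) (hxT : x₀ ∈ dom T)
    (hdir : DirInfBoundedAt S x₀) (hC1 : closure (dom S) ∈ C1 T)
    (hmax : ∀ K, IsClosed K → Convex ℝ K → x₀ ∈ interior K →
      IsMaximalMonotone (T + subdifferential (indicatorFun (closure (dom S) ∩ K)))) :
    IsMaximalMonotone (T + S) := by
  obtain ⟨hCcl, hCc, Y, hYcl, hY⟩ := hC1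
  have hYmem : ∀ a ∈ dom T, ∀ c ∈ closure (dom S), a - c ∈ Y := by
    intro a ha c hc
    rw [← SetLike.mem_coe, hY]
    simp only [mem_iUnion]
    exact ⟨1, one_pos, by
      rw [one_smul]
      exact ⟨a, subset_convexHull ℝ _ ha, c, hc, rfl⟩⟩
  refine isMaximalMonotone_of_forall (hT.1.add hS.1) fun z zs hz => ?_
  have hE : ∀ (ξ : X) (τ : StrongDual ℝ X) (M : ℝ), 0 ≤ M →
      ∃ a, ∃ t ∈ T a, ∃ s ∈ S a, (t + s - τ) (a - ξ) ≤ -(M * ‖a - ξ‖) := fun ξ τ M hM =>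
    exists_apply_sub_le hS hTS hxT hdir hCc hmax ξ τ hM
  obtain ⟨hzT, hzS⟩ := mem_dom_inter_of_forall hE hz
  have hTY : ∀ a ∈ dom T, a - z ∈ Y := fun a ha => hYmem a ha z (subset_closure hzS)
  have hSY : ∀ a ∈ dom S, a - z ∈ Y := fun a ha => by
    rw [← neg_sub]
    exact Y.neg_mem (hYmem z hzT a (subset_closure ha))
  obtain ⟨η, hη, N, hN, hNS⟩ := hdir.exists_forall_apply_sub_le hS.1 hCc
  obtain ⟨ρ, hρ, N', hN', hsub⟩ := hT.1.exists_forall_eq_sub hxT hCcl hCc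
    (subset_closure hdir.1) hYcl hY hYmem hη
  set V : Set (X × ℝ) := {q | ∃ v₁ ∈ Y, ∃ v₂ ∈ Y, ∃ β₁ β₂ : ℝ, (v₁, β₁) ∈ upperCone T z ∧
    (v₂, β₂) ∈ upperCone S z ∧ q = (v₁ - v₂, β₁ + β₂ - zs v₂)} with hV
  have h0T : ((0 : X), (0 : ℝ)) ∈ upperCone T z := by
    obtain ⟨t, ht⟩ := hzT
    simpa using hT.1.mem_upperCone z ht
  have h0S : ((0 : X), (0 : ℝ)) ∈ upperCone S z := by
    obtain ⟨s, hs⟩ := hzS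
    simpa using hS.1.mem_upperCone z hs
  have hVc : Convex ℝ V := by
    rintro _ ⟨v₁, hv₁, v₂, hv₂, β₁, β₂, h₁, h₂, rfl⟩ _ ⟨w₁, hw₁, w₂, hw₂, γ₁, γ₂, k₁, k₂, rfl⟩
      p q hp hq -
    refine ⟨p • v₁ + q • w₁, Y.add_mem (Y.smul_mem _ hv₁) (Y.smul_mem _ hw₁), p • v₂ + q • w₂,
      Y.add_mem (Y.smul_mem _ hv₂) (Y.smul_mem _ hw₂), p * β₁ + q * γ₁, p * β₂ + q * γ₂,
      add_mem_upperCone (smul_mem_upperCone hp h₁) (smul_mem_upperCone hq k₁),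
      add_mem_upperCone (smul_mem_upperCone hp h₂) (smul_mem_upperCone hq k₂), ?_⟩
    simp only [Prod.smul_mk, Prod.mk_add_mk, smul_eq_mul, map_add, map_smul, Prod.mk.injEq]
    exact ⟨by module, by ring⟩
  set M := (‖zs‖ * (η + ‖z - x₀‖) + N' * (1 + ‖z - x₀‖) + N * (1 + ‖z - x₀‖)) / ρ with hM
  have hM0 : 0 ≤ M := by positivity
  obtain ⟨t, ht⟩ := exists_dual_apply_le hVc
    ⟨_, 0, Y.zero_mem, 0, Y.zero_mem, 0, 0, h0T, h0S, rfl⟩ hM0 (by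
    rintro _ ⟨v₁, hv₁, v₂, hv₂, β₁, β₂, h₁, h₂, rfl⟩
    -- move both directions by a multiple of a small difference `e - c` so that they agree
    set u := v₁ - v₂ with hu
    set δ := ‖u‖ / ρ with hδ
    have hδ0 : 0 ≤ δ := by positivity
    obtain ⟨e, c, hc, he, hcη, hp⟩ := hsub ((ρ / ‖u‖) • (-u))
      (Y.smul_mem _ (Y.neg_mem (Y.sub_mem hv₁ hv₂))) (by
        rw [norm_smul, norm_neg, Real.norm_of_nonneg (by positivity)]
        rcases (norm_nonneg u).eq_or_lt with h | h
        · rw [← h, mul_zero]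
          exact hρ.le
        · rw [div_mul_cancel₀ _ h.ne'])
    have hδu : δ • (e - c) = v₂ - v₁ := by
      rw [← hp, smul_smul, ← neg_sub v₁ v₂, ← hu]
      rcases eq_or_ne u 0 with h | h
      · simp [h]
      · have : δ * (ρ / ‖u‖) = 1 := by
          rw [hδ]
          have := norm_ne_zero_iff.2 h
          field_simp
        rw [this, one_smul]
    have k₁ := add_mem_upperCone h₁ (smul_mem_upperCone hδ0 (mem_upperCone_of_forall_le hN' he z))
    have k₂ := add_mem_upperCone h₂ (smul_mem_upperCone hδ0 (mem_upperCone_of_forall_le hN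
      (fun a s hs => hNS a s hs c hc hcη) z))
    have heq : v₁ + δ • (e - z) = v₂ + δ • (c - z) := by
      rw [show e - z = (e - c) + (c - z) by abel, smul_add, hδu]
      abel
    rw [heq] at k₁
    have key := apply_le_of_mem_upperCone hT.1 hS.1 hE hz k₁ k₂
    rw [map_add, map_smul, smul_eq_mul] at key
    have h3 := (abs_le.1 (zs.le_opNorm (c - z))).1
    have h4 : ‖c - z‖ ≤ η + ‖z - x₀‖ := by
      rw [show c - z = (c - x₀) - (z - x₀) by abel]
      exact (norm_sub_le _ _).trans (by linarith)
    have h5 := mul_le_mul_of_nonneg_left h4 (norm_nonneg zs)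
    have h6 := mul_le_mul_of_nonneg_left (h3.trans' (neg_le_neg h5)) hδ0
    have h7 : M * ‖u‖ = δ * (‖zs‖ * (η + ‖z - x₀‖) + N' * (1 + ‖z - x₀‖)
        + N * (1 + ‖z - x₀‖)) := by
      rw [hM, hδ]; ring
    simp only
    rw [h7]
    linarith)
  refine ⟨t, hT.mem_of_forall fun a t' ht' => ?_, zs - t, hS.mem_of_forall fun a s hs => ?_, ?_⟩
  · have := ht _ ⟨a - z, hTY a ⟨t', ht'⟩, 0, Y.zero_mem, _, 0, hT.1.mem_upperCone z ht', h0S, rfl⟩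
    simpa using this
  · have := ht _ ⟨0, Y.zero_mem, a - z, hSY a ⟨s, hs⟩, 0, _, h0T, hS.1.mem_upperCone z hs, rfl⟩
    simp only [zero_sub, map_neg, zero_add] at this
    rw [sub_apply]
    linarith
  · exact add_sub_cancel t zs

/-! ### Interior points of the domain -/

theorem iUnion_smul_eq_univ {W : Set X} (hW : W ∈ nhds (0 : X)) :
    ⋃ (r : ℝ) (_ : 0 < r), r • W = univ := by
  obtain ⟨δ, hδ, hδW⟩ := Metric.nhds_basis_closedBall.mem_iff.1 hW
  refine eq_univ_of_forall fun p => ?_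
  obtain ⟨σ, hσ0, -, hσ⟩ := exists_norm_smul_le p hδ
  simp only [mem_iUnion]
  exact ⟨σ⁻¹, inv_pos.2 hσ0, σ • p, hδW (mem_closedBall_zero_iff.2 hσ), inv_smul_smul₀ hσ0.ne' p⟩

theorem opNorm_le_div_of_forall_le {s : StrongDual ℝ X} {r N : ℝ} (hr : 0 < r) (hN : 0 ≤ N)
    (h : ∀ v : X, ‖v‖ ≤ r → s v ≤ N) : ‖s‖ ≤ N / r := by
  have key : ∀ v : X, s v ≤ N / r * ‖v‖ := by
    intro v
    rcases (norm_nonneg v).eq_or_lt with hv | hv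
    · rw [norm_eq_zero.1 hv.symm]
      simp
    · have h1 := h ((r / ‖v‖) • v) (by
        rw [norm_smul, Real.norm_of_nonneg (by positivity), div_mul_cancel₀ _ hv.ne'])
      rw [map_smul, smul_eq_mul, div_mul_eq_mul_div, div_le_iff₀ hv] at h1
      rw [div_mul_eq_mul_div, le_div_iff₀ hr]
      linarith
  refine s.opNorm_le_bound (by positivity) fun v => ?_
  have h2 := key (-v)
  rw [map_neg, norm_neg] at h2
  exact abs_le.2 ⟨by linarith, key v⟩

/-- A monotone operator is locally bounded at the interior points of its domain. -/
theorem IsMonotone.exists_forall_norm_le [CompleteSpace X] (hS : IsMonotone S) {x₀ : X}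
    (hx : x₀ ∈ interior (dom S)) :
    ∃ ρ : ℝ, 0 < ρ ∧ ∃ N : ℝ, 0 ≤ N ∧ closedBall x₀ ρ ⊆ dom S ∧
      ∀ a, ∀ s ∈ S a, ‖a - x₀‖ ≤ ρ → ‖s‖ ≤ N := by
  have hnhds : dom S ∈ nhds x₀ := mem_interior_iff_mem_nhds.1 hx
  have hW : convexHull ℝ (dom S) - {x₀} ∈ nhds (0 : X) := by
    have h1 : Filter.Tendsto (fun p : X => p + x₀) (nhds 0) (nhds x₀) :=
      Continuous.tendsto' (by fun_prop) _ _ (zero_add _)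
    refine Filter.mem_of_superset (h1 hnhds) fun p hp => ?_
    exact ⟨p + x₀, subset_convexHull ℝ _ hp, x₀, rfl, add_sub_cancel_right p x₀⟩
  obtain ⟨ρ, hρ, N, hN, h⟩ := hS.exists_forall_eq_sub (interior_subset hx) isClosed_singleton
    (convex_singleton x₀) rfl (Y := ⊤) isClosed_univ (by rw [iUnion_smul_eq_univ hW]; rfl)
    (fun _ _ _ _ => Submodule.mem_top) one_pos
  obtain ⟨ρ', hρ', hball⟩ := Metric.nhds_basis_closedBall.mem_iff.1 hnhds
  refine ⟨min ρ' (ρ / 2), by positivity, N * (1 + ρ / 2) / (ρ / 2), by positivity,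
    (closedBall_subset_closedBall (min_le_left _ _)).trans hball, fun a s hs ha => ?_⟩
  refine opNorm_le_div_of_forall_le (by positivity) (by positivity) fun v hv => ?_
  have ha' : ‖a - x₀‖ ≤ ρ / 2 := ha.trans (min_le_right _ _)
  obtain ⟨e, c, hc, he, -, hp⟩ := h (a + v - x₀) Submodule.mem_top (by
    rw [show a + v - x₀ = (a - x₀) + v by abel]
    exact (norm_add_le _ _).trans (by linarith))
  rw [mem_singleton_iff.1 hc, sub_left_inj] at hp
  have h1 := he a s hs
  rw [← hp, add_sub_cancel_left] at h1
  exact h1.trans (mul_le_mul_of_nonneg_left (by linarith) hN)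

/-- Local boundedness at the points of the base of a cone bounds the whole cone by monotonicity. -/
theorem dirInfBoundedAt_of_mem_interior [CompleteSpace X] (hS : IsMonotone S) {x₀ : X}
    (hx : x₀ ∈ interior (dom S)) : DirInfBoundedAt S x₀ := by
  obtain ⟨ρ, hρ, N, hN, hdom, hbd⟩ := hS.exists_forall_norm_le hx
  refine ⟨interior_subset hx, fun y => ⟨ρ, hρ, N + 1, by positivity, ?_⟩⟩
  rintro _ ⟨⟨t, h0, h1, a, ha, rfl⟩, zs, hzs⟩
  obtain ⟨as, has⟩ := hdom ha
  have hle : ∀ v : X, as v ≤ (N + 1) * ‖v‖ := fun v => by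
    have h2 := (abs_le.1 (as.le_opNorm v)).2
    have h3 := mul_le_mul_of_nonneg_right (hbd a as has (mem_closedBall_iff_norm.1 ha))
      (norm_nonneg v)
    linarith [norm_nonneg v]
  rcases h1.eq_or_lt with rfl | h1
  · exact ⟨as, by simpa using has, hle _⟩
  · refine ⟨zs, hzs, le_trans ?_ (hle _)⟩
    -- `z - y` is a nonnegative multiple of `a - z`
    have h2 := hS.apply_le hzs has
    rw [show a - ((1 - t) • y + t • a) = (1 - t) • (a - y) by module, map_smul, map_smul,
      smul_eq_mul, smul_eq_mul] at h2
    rw [show (1 - t) • y + t • a - y = t • (a - y) by module, map_smul, map_smul,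
      smul_eq_mul, smul_eq_mul]
    exact mul_le_mul_of_nonneg_left (le_of_mul_le_mul_left h2 (by linarith)) h0

/-- The convex hull of the triples `(a - ξ, s, s (a - ξ))` with `s ∈ S a`. -/
def graphHull (S : X → Set (StrongDual ℝ X)) (ξ : X) : Set (X × StrongDual ℝ X × ℝ) :=
  convexHull ℝ {p | ∃ a, ∃ s ∈ S a, p = (a - ξ, s, s (a - ξ))}

/-- Monotonicity passes to convex combinations of the graph. -/
theorem IsMonotone.apply_add_apply_le (hS : IsMonotone S) {ξ : X}
    {p q : X × StrongDual ℝ X × ℝ} (hp : p ∈ graphHull S ξ) (hq : q ∈ graphHull S ξ) :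
    q.2.1 p.1 + p.2.1 q.1 ≤ p.2.2 + q.2.2 := by
  have hconv : ∀ q : X × StrongDual ℝ X × ℝ,
      Convex ℝ {p : X × StrongDual ℝ X × ℝ | q.2.1 p.1 + p.2.1 q.1 - p.2.2 ≤ q.2.2} := by
    intro q
    refine convex_halfSpace_le ⟨fun x y => ?_, fun c x => ?_⟩ _
    · simp only [Prod.fst_add, Prod.snd_add, map_add, add_apply]
      ring
    · simp only [Prod.smul_fst, Prod.smul_snd, map_smul, smul_apply, smul_eq_mul]
      ring
  have h1 : ∀ q ∈ {p | ∃ a, ∃ s ∈ S a, p = (a - ξ, s, s (a - ξ))}, ∀ p ∈ graphHull S ξ,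
      q.2.1 p.1 + p.2.1 q.1 - p.2.2 ≤ q.2.2 := by
    rintro _ ⟨a, s, hs, rfl⟩ p hp
    refine convexHull_min ?_ (hconv _) hp
    rintro _ ⟨a', s', hs', rfl⟩
    have h2 := hS.apply_le hs hs'
    rw [show a' - a = (a' - ξ) - (a - ξ) by abel, map_sub s, map_sub s'] at h2
    simp only [mem_ofPred_eq]
    linarith
  have h2 := convexHull_min (fun q hq => ?_) (hconv p) hq
  · simp only [mem_ofPred_eq] at h2
    linarith
  · have := h1 q hq p hp
    simp only [mem_ofPred_eq]
    linarith

/-- Points `ξ` around which the convex hull of the graph of a maximal monotone operator is bounded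
belong to its domain: the Hahn–Banach theorem produces a value at `ξ`. -/
theorem IsMaximalMonotone.mem_dom_of_graphHull (hS : IsMaximalMonotone S) {ξ : X} {r N : ℝ}
    (hr : 0 < r) (hN : 0 ≤ N)
    (h : ∀ v : X, ‖v‖ ≤ r → ∃ q ∈ graphHull S ξ, q.1 = v ∧ ‖q.2.1‖ ≤ N ∧ q.2.2 ≤ N) :
    ξ ∈ dom S := by
  have hbound : ∀ p ∈ graphHull S ξ, -((2 * N / r + 2 * N) * ‖p.1‖) ≤ p.2.2 := by
    intro p hp
    have h1 : ∀ v : X, ‖v‖ ≤ r → p.2.1 v - p.2.2 ≤ N * (1 + ‖p.1‖) := by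
      intro v hv
      obtain ⟨q, hq, rfl, hqσ, hqβ⟩ := h v hv
      have h2 := hS.1.apply_add_apply_le hp hq
      have h3 := (abs_le.1 (q.2.1.le_opNorm p.1)).1
      have h4 := mul_le_mul_of_nonneg_right hqσ (norm_nonneg p.1)
      linarith
    have h2 := hS.1.apply_add_apply_le hp hp
    rcases le_total 0 p.2.2 with h0 | h0
    · have : 0 ≤ (2 * N / r + 2 * N) * ‖p.1‖ := by positivity
      linarith
    rcases le_total 1 ‖p.1‖ with h3 | h3
    · have h4 := h1 0 (by simpa using hr.le)
      rw [map_zero] at h4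
      have h5 : 0 ≤ 2 * N / r * ‖p.1‖ := by positivity
      nlinarith
    · have h4 : ‖p.2.1‖ ≤ 2 * N / r := opNorm_le_div_of_forall_le hr (by positivity) fun v hv => by
        have := h1 v hv
        nlinarith
      have h5 := (abs_le.1 (p.2.1.le_opNorm p.1)).1
      have h6 := mul_le_mul_of_nonneg_right h4 (norm_nonneg p.1)
      have h7 : 0 ≤ 2 * N * ‖p.1‖ := by positivity
      linarith
  obtain ⟨q, hq, -⟩ := h 0 (by simpa using hr.le)
  have hlin : IsLinearMap ℝ fun p : X × StrongDual ℝ X × ℝ => (p.1, p.2.2) :=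
    ⟨fun _ _ => rfl, fun _ _ => rfl⟩
  obtain ⟨σ, hσ⟩ := exists_dual_apply_le ((convex_convexHull ℝ _).is_linear_image hlin)
    ⟨_, q, hq, rfl⟩ (show 0 ≤ 2 * N / r + 2 * N by positivity) (by
      rintro _ ⟨p, hp, rfl⟩
      exact hbound p hp)
  exact ⟨σ, hS.mem_of_forall fun a s hs =>
    hσ _ ⟨_, subset_convexHull ℝ _ ⟨a, s, hs, rfl⟩, rfl⟩⟩

/-- Points between `x₀` and a segment with endpoints in the domain are in the domain: a
small ball around such a point consists of convex combinations of the two endpoints with points near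
`x₀`, where `S` is bounded. -/
theorem IsMaximalMonotone.combo_mem_dom [CompleteSpace X] (hS : IsMaximalMonotone S) {x₀ : X}
    (hx : x₀ ∈ interior (dom S)) {y₁ y₂ : X} (hy₁ : y₁ ∈ dom S) (hy₂ : y₂ ∈ dom S)
    {α β η : ℝ} (hα : 0 ≤ α) (hβ : 0 ≤ β) (hαβ : α + β = 1) (hη : 0 < η) (hη1 : η ≤ 1) :
    (1 - η) • (α • y₁ + β • y₂) + η • x₀ ∈ dom S := by
  obtain ⟨ρ, hρ, N, hN, hdom, hbd⟩ := hS.1.exists_forall_norm_le hx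
  obtain ⟨s₁, hs₁⟩ := hy₁
  obtain ⟨s₂, hs₂⟩ := hy₂
  set ξ := (1 - η) • (α • y₁ + β • y₂) + η • x₀ with hξ
  set m := max (max ‖s₁‖ (s₁ (y₁ - ξ))) (max (max ‖s₂‖ (s₂ (y₂ - ξ)))
    (N * (1 + (‖x₀ - ξ‖ + ρ)))) with hm
  have hm0 : 0 ≤ m := (norm_nonneg s₁).trans ((le_max_left _ _).trans (le_max_left _ _))
  refine hS.mem_dom_of_graphHull (r := η * ρ) (N := m) (by positivity) hm0 fun v hv => ?_
  set e := x₀ + η⁻¹ • v with he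
  have hex : ‖e - x₀‖ ≤ ρ := by
    rw [he, add_sub_cancel_left, norm_smul, Real.norm_of_nonneg (by positivity),
      inv_mul_le_iff₀ hη]
    exact hv
  obtain ⟨s, hs⟩ := hdom (mem_closedBall_iff_norm.2 hex)
  have hsN := hbd e s hs hex
  have heξ : ‖e - ξ‖ ≤ ‖x₀ - ξ‖ + ρ := by
    rw [show e - ξ = (x₀ - ξ) + (e - x₀) by abel]
    exact (norm_add_le _ _).trans (by linarith)
  have hsm : N * (1 + (‖x₀ - ξ‖ + ρ)) ≤ m := (le_max_right _ _).trans (le_max_right _ _)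
  have h1 : ‖s₁‖ ≤ m ∧ s₁ (y₁ - ξ) ≤ m :=
    max_le_iff.1 (le_max_left _ _)
  have h2 : ‖s₂‖ ≤ m ∧ s₂ (y₂ - ξ) ≤ m :=
    max_le_iff.1 ((le_max_left _ _).trans (le_max_right _ _))
  have h3 : ‖s‖ ≤ m ∧ s (e - ξ) ≤ m := by
    have h4 : 0 ≤ ‖x₀ - ξ‖ + ρ := by positivity
    have h5 := mul_le_mul hsN heξ (norm_nonneg _) hN
    have h6 := (abs_le.1 (s.le_opNorm (e - ξ))).2
    have h7 : 0 ≤ N * (‖x₀ - ξ‖ + ρ) := by positivity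
    constructor <;> linarith
  have hconv : Convex ℝ {q : X × StrongDual ℝ X × ℝ | ‖q.2.1‖ ≤ m ∧ q.2.2 ≤ m} := by
    rintro q ⟨hq, hq'⟩ q' ⟨hr, hr'⟩ a b ha hb hab
    have hmm : (a + b) * m = m := by rw [hab, one_mul]
    constructor
    · refine (norm_add_le _ _).trans ?_
      simp only [Prod.smul_fst, Prod.smul_snd]
      rw [norm_smul, norm_smul, Real.norm_of_nonneg ha, Real.norm_of_nonneg hb]
      linarith [mul_le_mul_of_nonneg_left hq ha, mul_le_mul_of_nonneg_left hr hb]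
    · simp only [Prod.smul_snd, Prod.snd_add, smul_eq_mul]
      linarith [mul_le_mul_of_nonneg_left hq' ha, mul_le_mul_of_nonneg_left hr' hb]
  have hconv' := (convex_convexHull ℝ {p | ∃ a, ∃ s ∈ S a, p = (a - ξ, s, s (a - ξ))}).inter hconv
  have hmem : ∀ {y : X} {s : StrongDual ℝ X}, s ∈ S y → ‖s‖ ≤ m ∧ s (y - ξ) ≤ m →
      (y - ξ, s, s (y - ξ)) ∈ convexHull ℝ {p | ∃ a, ∃ s ∈ S a, p = (a - ξ, s, s (a - ξ))} ∩
        {q : X × StrongDual ℝ X × ℝ | ‖q.2.1‖ ≤ m ∧ q.2.2 ≤ m} := fun {y s} hy h =>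
    ⟨subset_convexHull ℝ _ ⟨y, s, hy, rfl⟩, h⟩
  have hq := hconv' (hconv' (hmem hs₁ h1) (hmem hs₂ h2) hα hβ hαβ) (hmem hs h3)
    (show 0 ≤ 1 - η by linarith) hη.le (by ring)
  refine ⟨_, hq.1, ?_, hq.2⟩
  have hβ' : β = 1 - α := by linarith
  have hv' : η • e = η • x₀ + v := by rw [he, smul_add, smul_inv_smul₀ hη.ne']
  simp only [Prod.fst_add, Prod.smul_fst]
  rw [smul_sub η, hv', hξ, hβ']
  module

/-- The domain of a maximal monotone operator has convex closure if it has an interior point. -/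
theorem IsMaximalMonotone.convex_closure_dom [CompleteSpace X] (hS : IsMaximalMonotone S) {x₀ : X}
    (hx : x₀ ∈ interior (dom S)) : Convex ℝ (closure (dom S)) := by
  intro y₁ hy₁ y₂ hy₂ α β hα hβ hαβ
  have key : ∀ y₁ ∈ dom S, ∀ y₂ ∈ dom S, α • y₁ + β • y₂ ∈ closure (dom S) := by
    intro y₁ hy₁ y₂ hy₂
    have h1 : Filter.Tendsto (fun η : ℝ => (1 - η) • (α • y₁ + β • y₂) + η • x₀)
        (nhdsWithin 0 (Ioi 0)) (nhds (α • y₁ + β • y₂)) :=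
      Filter.Tendsto.mono_left (Continuous.tendsto' (by fun_prop) _ _ (by simp))
        nhdsWithin_le_nhds
    refine mem_closure_of_tendsto h1 ?_
    filter_upwards [Ioc_mem_nhdsGT (zero_lt_one' ℝ)] with η hη
    exact hS.combo_mem_dom hx hy₁ hy₂ hα hβ hαβ hη.1 hη.2
  have h2 := map_mem_closure₂ (f := fun y₁ y₂ : X => α • y₁ + β • y₂) (by fun_prop) hy₁ hy₂ key
  rwa [closure_closure] at h2

/-! ### The constraint sets -/

theorem mem_C1_of_mem_interior {C : Set X} (hCcl : IsClosed C) (hC : Convex ℝ C) {x₀ : X}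
    (hxT : x₀ ∈ dom T) (hx : x₀ ∈ interior C) : C ∈ C1 T := by
  refine ⟨hCcl, hC, ⊤, isClosed_univ, ?_⟩
  rw [iUnion_smul_eq_univ, Submodule.top_coe]
  have h1 : Filter.Tendsto (fun p : X => x₀ - p) (nhds 0) (nhds x₀) :=
    Continuous.tendsto' (by fun_prop) _ _ (sub_zero _)
  refine Filter.mem_of_superset (h1 (mem_interior_iff_mem_nhds.1 hx)) fun p hp => ?_
  exact ⟨x₀, subset_convexHull ℝ _ hxT, x₀ - p, hp, sub_sub_cancel x₀ p⟩

/-- Intersecting with a neighbourhood of a point of `dom T ∩ C` does not change the cone generated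
by `convexHull ℝ (dom T) - C`. -/
theorem inter_mem_C1 {C K : Set X} (hC : C ∈ C1 T) {x₀ : X} (hxT : x₀ ∈ dom T) (hxC : x₀ ∈ C)
    (hKcl : IsClosed K) (hK : Convex ℝ K) (hxK : x₀ ∈ interior K) : C ∩ K ∈ C1 T := by
  obtain ⟨hCcl, hCc, Y, hYcl, hY⟩ := hC
  refine ⟨hCcl.inter hKcl, hCc.inter hK, Y, hYcl, hY.trans (Subset.antisymm ?_ ?_)⟩
  · intro p hp
    simp only [mem_iUnion] at hp ⊢
    obtain ⟨r, hr, _, ⟨u, hu, c, hc, rfl⟩, rfl⟩ := hp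
    obtain ⟨δ, hδ, hball⟩ := Metric.nhds_basis_closedBall.mem_iff.1
      (mem_interior_iff_mem_nhds.1 hxK)
    obtain ⟨σ, hσ0, hσ1, hσ⟩ := exists_norm_smul_le (c - x₀) hδ
    refine ⟨r / σ, by positivity, _, ⟨(1 - σ) • x₀ + σ • u,
      convex_convexHull ℝ _ (subset_convexHull ℝ _ hxT) hu (by linarith) hσ0.le (by ring),
      (1 - σ) • x₀ + σ • c, ⟨hCc hxC hc (by linarith) hσ0.le (by ring), hball ?_⟩, rfl⟩, ?_⟩
    · rwa [mem_closedBall_iff_norm, show (1 - σ) • x₀ + σ • c - x₀ = σ • (c - x₀) by module]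
    · simp only
      rw [show (1 - σ) • x₀ + σ • u - ((1 - σ) • x₀ + σ • c) = σ • (u - c) by module,
        smul_smul, div_mul_cancel₀ _ hσ0.ne']
  · exact iUnion₂_mono fun r _ => smul_set_mono (sub_subset_sub_left inter_subset_left)

end MonotoneOperator

theorem theorem2p14 {X : Type*} [NormedAddCommGroup X] [NormedSpace ℝ X] [CompleteSpace X]
    (T S : X → Set (StrongDual ℝ X))
    (hT : MonotoneOperator.IsMaximalMonotone T)
    (hS : MonotoneOperator.IsMaximalMonotone S)
    (hTS : MonotoneOperator.dom T ∩ closure (MonotoneOperator.dom S) ⊆ MonotoneOperator.dom S) :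
    (MonotoneOperator.IsC1Maximal T →
      closure (MonotoneOperator.dom S) ∈ MonotoneOperator.C1 T →
      (∃ x₀ ∈ MonotoneOperator.dom T ∩ MonotoneOperator.dom S,
        MonotoneOperator.DirInfBoundedAt S x₀) →
      MonotoneOperator.IsMaximalMonotone (T + S)) ∧
    (MonotoneOperator.IsC0Maximal T →
      (MonotoneOperator.dom T ∩ interior (MonotoneOperator.dom S)).Nonempty →
      MonotoneOperator.IsMaximalMonotone (T + S)) := by
  refine ⟨?_, ?_⟩
  · rintro hmax hC ⟨x₀, ⟨hxT, hxS⟩, hdir⟩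
    exact MonotoneOperator.isMaximalMonotone_add hT hS hTS hxT hdir hC fun K hKcl hK hxK =>
      hmax _ (MonotoneOperator.inter_mem_C1 hC hxT (subset_closure hxS) hKcl hK hxK)
  · rintro hmax ⟨x₀, hxT, hxS⟩
    have hconv := hS.convex_closure_dom hxS
    have hxC := interior_mono subset_closure hxS
    refine MonotoneOperator.isMaximalMonotone_add hT hS hTS hxT
      (MonotoneOperator.dirInfBoundedAt_of_mem_interior hS.1 hxS)
      (MonotoneOperator.mem_C1_of_mem_interior isClosed_closure hconv hxT hxC)
      fun K hKcl hK hxK => hmax _ ⟨isClosed_closure.inter hKcl, hconv.inter hK, x₀, hxT, ?_⟩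
    rw [interior_inter]
    exact ⟨hxC, hxK⟩
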